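/- Let $G=(N,E)$ be a finite connected simple graph with edge-weights $w:E\to\mathbb{R}$ taking exactly three different values $\sigma_1<\sigma_2<\sigma_3$, and let $E_k=\{e\in E: w(e)=\sigma_k\}$. For $A\subseteq N$ let $E(A)$ be the set of edges of $G$ with both ends in $A$, let $\Sigma(A)\subseteq E(A)$ be the set of edges of minimum weight in $E(A)$, and let $\mathcal{P}_{\min}(A)$ be the partition of $A$ into the vertex sets of the connected components of $(A,E(A)\setminus\Sigma(A))$. A (zero-normalized) game on $N$ is a function $v:2^N\to\mathbb{R}$ with $v(\emptyset)=0$ and $v(\{i\})=0$ for all $i\in N$. It is convex if $v(A\cup B)+v(A\cap B)\ge v(A)+v(B)$ for all $A,B\subseteq N$. Its $\mathcal{P}_{\min}$-restricted game is $\overline{v}(A)=\sum_{F\in\mathcal{P}_{\min}(A)}v(F)$. There is inheritance of convexity for $\mathcal{P}_{\min}$ if $\overline{v}$ is convex for every convex game $v$. Cycles are simple; a cycle is chordless if every edge of $G$ joining two of its vertices is an edge of the cycle; two cycles are identified if they have the same edges; two cycles are adjacent if they share an edge. A graph is cycle-complete if the vertices of each of its cycles are pairwise adjacent in it. An edge $e$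 is linked to a vertex $v$ by an edge $e'$ if $e'$ joins an end-vertex of $e$ to $v$. Then there is inheritance of convexity for $\mathcal{P}_{\min}$ if and only if, for some vertices denoted $1$ and $2$, the following five conditions hold: 1. There is only one edge $e_1=\{1,2\}$ in $E_1$. 2. Every edge in $E_2$ is incident to the end-vertex $2$ of $e_1$. 3. Every edge in $E_3$ is linked to $2$ by $e_1$ or by an edge in $E_2$. 4. There is at most one chordless cycle of length $3$ or $4$ containing $e_1$. 5. $G_1=(N,E\setminus E_1)$ is cycle-complete. Moreover, whenever vertices $1,2$ satisfy conditions 1--5, the following holds: 6. If a cycle $C_m$ of length $m$ in $G$ does not contain the edge $e_1$ and passes through the vertex $1$, then $m=3$, it is the only such cycle, all its edges have weight $\sigma_3$, and it is adjacent to a unique triangle $\tilde{C}_3$ containing $e_1$. Moreover, $\tilde{C}_3$ has vertices $1,2,3$ (for some vertex denoted $3$) and edges $e_1=\{1,2\}$, $e_2=\{2,3\}$, $e_3=\{3,1\}$ of weights $\sigma_1,\sigma_2,\sigma_3$ respectively, and the set of common edges of $C_3$ and $\tilde{C}_3$ is $\{e_3\}$. -/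

import Mathlib

namespace PminGame

/-! ### Cooperative games

A game on the finite player set `N` is a set function `v : Finset N → ℝ` with `v ∅ = 0`. -/

/-- `v` is the characteristic function of a zero-normalized game: `v ∅ = 0` and `v {i} = 0`. -/
structure IsZeroNormalizedGame {N : Type*} (v : Finset N → ℝ) : Prop where
  empty : v ∅ = 0
  singleton : ∀ i : N, v {i} = 0

/-- A game is convex if its characteristic function is supermodular. -/
def IsConvexGame {N : Type*} [DecidableEq N] (v : Finset N → ℝ) : Prop :=
  ∀ A B : Finset N, v A + v B ≤ v (A ∪ B) + v (A ∩ B)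

/-! ### Weighted graphs and the correspondence `P_min`

A weighted graph is a simple graph `G` with `w : Sym2 N → ℝ`; only the values of `w` on the
edges of `G` are ever used. -/

/-- `E(A)`: the edges of `G` with both ends in `A`. -/
def edgesIn {N : Type*} (G : SimpleGraph N) (A : Finset N) : Set (Sym2 N) :=
  {e | e ∈ G.edgeSet ∧ ∀ x ∈ e, x ∈ A}

/-- `Σ(A)`: the edges of minimum weight in the subgraph of `G` induced by `A`. -/
def minEdges {N : Type*} (G : SimpleGraph N) (w : Sym2 N → ℝ) (A : Finset N) : Set (Sym2 N) :=
  {e | e ∈ edgesIn G A ∧ ∀ e' ∈ edgesIn G A, w e ≤ w e'}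

/-- The graph with edge set `E(A) \ Σ(A)`, on the whole of `N` (vertices outside `A` are
isolated, so its components meeting `A` are those of `(A, E(A) \ Σ(A))`). -/
def strongGraph {N : Type*} (G : SimpleGraph N) (w : Sym2 N → ℝ) (A : Finset N) :
    SimpleGraph N :=
  SimpleGraph.fromEdgeSet (edgesIn G A \ minEdges G w A)

open scoped Classical in
/-- `P_min(A)`: the partition of `A` into the vertex sets of the connected components of
`(A, E(A) \ Σ(A))`. -/
noncomputable def Pmin {N : Type*} [DecidableEq N] (G : SimpleGraph N) (w : Sym2 N → ℝ)
    (A : Finset N) : Finset (Finset N) :=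
  A.image fun i => A.filter fun j => (strongGraph G w A).Reachable i j

/-- The `P_min`-restricted game: `A ↦ ∑_{F ∈ P_min(A)} v(F)`. -/
noncomputable def restrictedGame {N : Type*} [DecidableEq N] (G : SimpleGraph N)
    (w : Sym2 N → ℝ) (v : Finset N → ℝ) : Finset N → ℝ :=
  fun A => ∑ F ∈ Pmin G w A, v F

/-- Inheritance of convexity for `P_min`: the restricted game of every convex game is convex. -/
def InheritsConvexity {N : Type*} [DecidableEq N] (G : SimpleGraph N) (w : Sym2 N → ℝ) : Prop :=
  ∀ v : Finset N → ℝ, IsZeroNormalizedGame v → IsConvexGame v →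
    IsConvexGame (restrictedGame G w v)

/-! ### Graph conditions -/

/-- The edges of `G` of weight `σ`. -/
def weightClass {N : Type*} (G : SimpleGraph N) (w : Sym2 N → ℝ) (σ : ℝ) : Set (Sym2 N) :=
  {e | e ∈ G.edgeSet ∧ w e = σ}

/-- The edge `e` is linked to the vertex `v` by the edge `e'`: `e'` joins an end of `e` to `v`. -/
def IsLinkedBy {N : Type*} (e : Sym2 N) (v : N) (e' : Sym2 N) : Prop :=
  ∃ u ∈ e, e' = s(u, v)

/-- A graph is cycle-complete if the vertex set of every (simple) cycle induces a complete
subgraph. -/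
def IsCycleComplete {N : Type*} (H : SimpleGraph N) : Prop :=
  ∀ (u : N) (p : H.Walk u u), p.IsCycle → H.IsClique {x | x ∈ p.support}

/-- The five conditions, for the edge `e₁ = s(v₁, v₂)`. Two cycles are the same when they have
the same edges. -/
structure StructureConditions {N : Type*} (G : SimpleGraph N) (w : Sym2 N → ℝ)
    (σ₁ σ₂ σ₃ : ℝ) (v₁ v₂ : N) : Prop where
  /-- `e₁` is the only edge of weight `σ₁`. -/
  unique_min_edge : weightClass G w σ₁ = {s(v₁, v₂)}
  /-- Every edge of weight `σ₂` is incident to `v₂`. -/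
  middle_incident : ∀ e ∈ weightClass G w σ₂, v₂ ∈ e
  /-- Every edge of weight `σ₃` is linked to `v₂` by `e₁` or by an edge of weight `σ₂`. -/
  max_linked : ∀ e ∈ weightClass G w σ₃,
    IsLinkedBy e v₂ s(v₁, v₂) ∨ ∃ e' ∈ weightClass G w σ₂, IsLinkedBy e v₂ e'
  /-- At most one chordless cycle of length 3 or 4 contains `e₁`. -/
  short_cycle_unique : ∀ (a b : N) (p : G.Walk a a) (q : G.Walk b b),
    p.IsCycle → p.IsChordless → (p.length = 3 ∨ p.length = 4) → s(v₁, v₂) ∈ p.edgeSet →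
    q.IsCycle → q.IsChordless → (q.length = 3 ∨ q.length = 4) → s(v₁, v₂) ∈ q.edgeSet →
    p.edgeSet = q.edgeSet
  /-- The graph obtained by deleting the edges of weight `σ₁` is cycle-complete. -/
  cycleComplete : IsCycleComplete (G.deleteEdges (weightClass G w σ₁))

/-- The cycle `p` passes through `v₁` and does not contain the edge `s(v₁, v₂)`. -/
def IsAvoidingCycle {N : Type*} {G : SimpleGraph N} (v₁ v₂ : N) {a : N} (p : G.Walk a a) : Prop :=
  p.IsCycle ∧ v₁ ∈ p.support ∧ s(v₁, v₂) ∉ p.edgeSet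

/-- Every cycle through `v₁` that does not contain `e₁ = s(v₁, v₂)` has length 3, is the only
such cycle, has constant weight `σ₃`, and is adjacent to (shares an edge with) a unique triangle
containing `e₁`; the vertices of that triangle are `v₁, v₂, v₃`, the weights of its edges
`s(v₁, v₂)`, `s(v₂, v₃)`, `s(v₃, v₁)` are `σ₁, σ₂, σ₃`, and the common edges of the
two cycles are exactly `s(v₃, v₁)`. -/
def AvoidingCycleStructure {N : Type*} (G : SimpleGraph N) (w : Sym2 N → ℝ)
    (σ₁ σ₂ σ₃ : ℝ) (v₁ v₂ : N) : Prop :=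
  ∀ (a : N) (p : G.Walk a a), IsAvoidingCycle v₁ v₂ p →
    p.length = 3 ∧
    (∀ (b : N) (q : G.Walk b b), IsAvoidingCycle v₁ v₂ q → q.edgeSet = p.edgeSet) ∧
    (∀ e ∈ p.edgeSet, w e = σ₃) ∧
    ∃ v₃ : N, G.Adj v₁ v₂ ∧ G.Adj v₂ v₃ ∧ G.Adj v₃ v₁ ∧
      w s(v₁, v₂) = σ₁ ∧ w s(v₂, v₃) = σ₂ ∧ w s(v₃, v₁) = σ₃ ∧
      p.edgeSet ∩ {s(v₁, v₂), s(v₂, v₃), s(v₃, v₁)} = {s(v₃, v₁)} ∧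
      ∀ (b : N) (q : G.Walk b b), q.IsCycle → q.length = 3 → s(v₁, v₂) ∈ q.edgeSet →
        (p.edgeSet ∩ q.edgeSet).Nonempty →
        q.edgeSet = {s(v₁, v₂), s(v₂, v₃), s(v₃, v₁)}

end PminGame

namespace PminGame

/-! Let `G₁` be `G` without the edges of weight `σ₁`.

Sufficiency. Conditions 1–3 force the non-minimal edges of `A` to be exactly the edges of `G₁`
inside a subset `core v₁ v₂ A`: it is `A` if both `v₁` and `v₂` lie in `A`, it is `A` without `v₂`
if only `v₂` does, and it is empty if `v₂` does not (`strongGraph_eq`). The restricted game is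
therefore the graph-restricted game of `G₁` evaluated at the core. Since `G₁` is cycle-complete,
that game is convex (`IsCycleComplete.isConvexGame_componentSum`): when a player joins a larger
coalition, the components it merges cut the smaller merged set into the same pieces as before. On
sets containing `v₂` the core respects unions and intersections; if one set misses `v₂`,
monotonicity suffices.

Necessity. For the unanimity game of a pair, inheritance says that two vertices connected by
non-minimal edges in `A` and in `B` are so connected in `A ∩ B`
(`InheritsConvexity.reachable_inter`). Well-chosen small sets make `A ∩ B` too poor in edges unless
the conditions hold: lighter edges meet outside heavier ones, hence form a star centred at `v₂`, and
arcs of a cycle force its chords. Condition 4 follows from condition 5, because two short paths from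
`v₁` to `v₂` in `G₁` would put these non-adjacent vertices on a common cycle.

Condition 6. A cycle through `v₁` avoiding `e₁` is a clique in `G₁`. Each of its edges away from
`v₁` has an end joined to `v₂`, while `v₁` and `v₂` have at most one common neighbour, so there is
room for only two further vertices. -/

open scoped Classical in
/-- The blocks of the relation `r` on the finite set `X`. -/
noncomputable def blocks {N : Type*} [DecidableEq N] (r : N → N → Prop) (X : Finset N) :
    Finset (Finset N) :=
  X.image fun i => X.filter fun j => r i j

/-- The sum of `v` over the blocks of `r` on `X`. -/
noncomputable def blockSum {N : Type*} [DecidableEq N] (r : N → N → Prop) (v : Finset N → ℝ)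
    (X : Finset N) : ℝ :=
  ∑ F ∈ blocks r X, v F

/-! ### Sums of a convex game over the classes of an equivalence relation -/

section BlockSum

variable {N : Type*} [DecidableEq N] {r r' : N → N → Prop} {v : Finset N → ℝ}

lemma blockSum_empty : blockSum r v ∅ = 0 := by
  simp [blockSum, blocks]

lemma blockSum_congr {X : Finset N} (h : ∀ i ∈ X, ∀ j ∈ X, r i j ↔ r' i j) :
    blockSum r v X = blockSum r' v X := by
  classical
  have : blocks r X = blocks r' X := by
    unfold blocks
    refine Finset.image_congr fun i hi => ?_
    exact Finset.filter_congr fun j hj => h i hi j hj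
  rw [blockSum, blockSum, this]

lemma blockSum_union {X Y : Finset N} (hr : Equivalence r) (hd : Disjoint X Y)
    (h : ∀ i ∈ X, ∀ j ∈ Y, ¬ r i j) :
    blockSum r v (X ∪ Y) = blockSum r v X + blockSum r v Y := by
  classical
  have hX : blocks r (X ∪ Y) = blocks r X ∪ blocks r Y := by
    unfold blocks
    rw [Finset.image_union]
    congr 1
    · refine Finset.image_congr fun i hi => ?_
      ext j
      have := h i hi j
      simp only [Finset.mem_filter, Finset.mem_union]
      tauto
    · refine Finset.image_congr fun i hi => ?_
      ext j
      have h1 := fun hj => h j hj i hi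
      have h2 := @Equivalence.symm _ _ hr i j
      simp only [Finset.mem_filter, Finset.mem_union]
      tauto
  rw [blockSum, hX, Finset.sum_union]
  · rfl
  · rw [Finset.disjoint_left]
    intro F hF hF'
    obtain ⟨i, hi, rfl⟩ := Finset.mem_image.1 hF
    obtain ⟨j, hj, hij⟩ := Finset.mem_image.1 hF'
    have h1 : i ∈ X.filter (fun j => r i j) := Finset.mem_filter.2 ⟨hi, hr.refl i⟩
    rw [← hij] at h1
    exact Finset.disjoint_left.1 hd hi (Finset.mem_filter.1 h1).1

lemma blockSum_of_forall {X : Finset N} (hv : v ∅ = 0) (h : ∀ i ∈ X, ∀ j ∈ X, r i j) :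
    blockSum r v X = v X := by
  classical
  rcases X.eq_empty_or_nonempty with rfl | hX
  · rw [blockSum_empty, hv]
  · have : blocks r X = {X} := by
      unfold blocks
      rw [Finset.image_congr (g := fun _ => X), Finset.image_const hX]
      intro i hi
      exact Finset.filter_true_of_mem fun j hj => h i hi j hj
    rw [blockSum, this, Finset.sum_singleton]

lemma blockSum_of_trivial {X : Finset N} (hv : IsZeroNormalizedGame v) (hr : Equivalence r)
    (h : ∀ i ∈ X, ∀ j ∈ X, r i j → i = j) : blockSum r v X = 0 := by
  classical
  refine Finset.sum_eq_zero fun F hF => ?_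
  obtain ⟨i, hi, rfl⟩ := Finset.mem_image.1 hF
  have : X.filter (fun j => r i j) = {i} := by
    ext j
    simp only [Finset.mem_filter, Finset.mem_singleton]
    constructor
    · rintro ⟨hj, hij⟩
      exact (h i hi j hj hij).symm
    · rintro rfl
      exact ⟨hi, hr.refl _⟩
  rw [this, hv.singleton]

lemma blockSum_filter_add (hr : Equivalence r) (hv : v ∅ = 0) (j : N) (X : Finset N)
    [DecidablePred (r j)] :
    blockSum r v X = v (X.filter (r j)) + blockSum r v (X.filter fun i => ¬ r j i) := by
  conv_lhs => rw [← Finset.filter_union_filter_not_eq (r j) X]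
  rw [blockSum_union hr (Finset.disjoint_filter_filter_not _ _ _), blockSum_of_forall hv]
  · intro a ha b hb
    exact hr.trans (hr.symm (Finset.mem_filter.1 ha).2) (Finset.mem_filter.1 hb).2
  · intro a ha b hb hab
    exact (Finset.mem_filter.1 hb).2 (hr.trans (Finset.mem_filter.1 ha).2 hab)

/-- The excess of a convex game over its sum over blocks is monotone. -/
lemma sub_blockSum_le_sub_blockSum (hr : Equivalence r) (hv : v ∅ = 0) (hc : IsConvexGame v)
    {X Y : Finset N} (h : X ⊆ Y) : v X - blockSum r v X ≤ v Y - blockSum r v Y := by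
  classical
  obtain ⟨D, rfl⟩ : ∃ D, Y = X ∪ D := ⟨Y, (Finset.union_eq_right.2 h).symm⟩
  clear h
  induction D using Finset.induction_on with
  | empty => simp
  | insert j D hj ih =>
    refine ih.trans ?_
    rw [Finset.union_insert]
    set Z := X ∪ D
    by_cases hjZ : j ∈ Z
    · rw [Finset.insert_eq_of_mem hjZ]
    rw [blockSum_filter_add hr hv j Z, blockSum_filter_add hr hv j (insert j Z),
      Finset.filter_insert, Finset.filter_insert, if_pos (hr.refl j),
      if_neg (not_not.2 (hr.refl j))]
    -- Adding `j` changes only its own block. Supermodularity says that `j` contributes at least as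
    -- much to all of `Z` as to that block.
    have := hc Z (insert j (Z.filter (r j)))
    have h1 : Z ∪ insert j (Z.filter (r j)) = insert j Z := by
      rw [Finset.union_insert, Finset.union_eq_left.2 (Finset.filter_subset _ _)]
    have h2 : Z ∩ insert j (Z.filter (r j)) = Z.filter (r j) := by
      rw [Finset.inter_insert_of_notMem hjZ, Finset.inter_eq_right.2 (Finset.filter_subset _ _)]
    rw [h1, h2] at this
    linarith

lemma blockSum_le (hr : Equivalence r) (hv : v ∅ = 0) (hc : IsConvexGame v) (X : Finset N) :
    blockSum r v X ≤ v X := by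
  have := sub_blockSum_le_sub_blockSum hr hv hc (Finset.empty_subset X)
  rw [blockSum_empty, hv] at this
  linarith

/-- One class of the coarser relation is split off at a time; on it the finer sum is at most the
value of the class, by `blockSum_le`. -/
lemma blockSum_mono (hr : Equivalence r) (hr' : Equivalence r') (hv : v ∅ = 0)
    (hc : IsConvexGame v) (h : ∀ i j, r i j → r' i j) (X : Finset N) :
    blockSum r v X ≤ blockSum r' v X := by
  classical
  induction X using Finset.strongInduction with
  | H X ih =>
    rcases X.eq_empty_or_nonempty with rfl | ⟨i, hi⟩
    · simp [blockSum_empty]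
    have h1 : blockSum r v X = blockSum r v (X.filter (r' i)) +
        blockSum r v (X.filter fun j => ¬ r' i j) := by
      conv_lhs => rw [← Finset.filter_union_filter_not_eq (r' i) X]
      refine blockSum_union hr (Finset.disjoint_filter_filter_not _ _ _) fun a ha b hb hab => ?_
      exact (Finset.mem_filter.1 hb).2 (hr'.trans (Finset.mem_filter.1 ha).2 (h _ _ hab))
    rw [h1, blockSum_filter_add hr' hv i X]
    refine add_le_add (blockSum_le hr hv hc _) (ih _ ?_)
    exact Finset.filter_ssubset.2 ⟨i, hi, not_not.2 (hr'.refl i)⟩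

end BlockSum

/-- A set function with increasing marginal contributions is supermodular. -/
lemma isConvexGame_of_marginal {N : Type*} [DecidableEq N] {f : Finset N → ℝ}
    (h : ∀ A B : Finset N, A ⊆ B → ∀ j ∉ B, f (insert j A) - f A ≤ f (insert j B) - f B) :
    IsConvexGame f := by
  have key : ∀ D C B : Finset N, C ⊆ B → Disjoint D B → f (C ∪ D) - f C ≤ f (B ∪ D) - f B := by
    intro D
    induction D using Finset.induction_on with
    | empty => simp
    | insert j D hj ih =>
      intro C B hCB hd
      rw [Finset.disjoint_insert_left] at hd
      have h1 := ih C B hCB hd.2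
      have h2 := h (C ∪ D) (B ∪ D) (Finset.union_subset_union_left hCB) j
        (by simp [hj, hd.1])
      rw [Finset.union_insert, Finset.union_insert]
      linarith
  intro A B
  have := key (A \ B) (A ∩ B) B Finset.inter_subset_right Finset.sdiff_disjoint
  rw [Finset.union_comm (A ∩ B), Finset.sdiff_union_inter, Finset.union_sdiff_self_eq_union,
    Finset.union_comm B] at this
  linarith


/-! ### Induced subgraphs and cycle-complete graphs -/

/-- The graph on `N` with those edges of `H` that have both ends in `A`. -/
def restrictTo {N : Type*} (H : SimpleGraph N) (A : Finset N) : SimpleGraph N where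
  Adj x y := H.Adj x y ∧ x ∈ A ∧ y ∈ A
  symm := ⟨fun _ _ h => ⟨h.1.symm, h.2.2, h.2.1⟩⟩
  loopless := ⟨fun _ h => h.1.ne rfl⟩

section Restriction

variable {N : Type*} {H : SimpleGraph N}

lemma restrictTo_le (A : Finset N) : restrictTo H A ≤ H := fun _ _ h => h.1

lemma restrictTo_mono {A B : Finset N} (h : A ⊆ B) : restrictTo H A ≤ restrictTo H B :=
  fun _ _ hxy => ⟨hxy.1, h hxy.2.1, h hxy.2.2⟩

lemma eq_of_reachable_of_isolated {x y : N} (h : H.Reachable x y) (hx : ∀ z, ¬ H.Adj x z) :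
    x = y := by
  obtain ⟨p⟩ := h
  cases p with
  | nil => rfl
  | cons h _ => exact (hx _ h).elim

lemma not_reachable_restrictTo {A : Finset N} {j y : N} (hj : j ∉ A) (hy : y ≠ j) :
    ¬ (restrictTo H A).Reachable j y := fun h =>
  hy (eq_of_reachable_of_isolated h fun _ hz => hj hz.2.1).symm

lemma support_subset_of_restrictTo {A : Finset N} {x y : N} (p : (restrictTo H A).Walk x y)
    (hx : x ∈ A) : ∀ z ∈ p.support, z ∈ A := by
  induction p with
  | nil => simpa using hx
  | cons h p ih =>
    intro z hz
    rw [SimpleGraph.Walk.support_cons, List.mem_cons] at hz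
    rcases hz with rfl | hz
    · exact hx
    · exact ih h.2.2 z hz

/-- In a cycle-complete graph, a path closed up by a further vertex spans a clique. -/
lemma IsCycleComplete.isClique_of_isPath (hH : IsCycleComplete H) {j x y : N} (p : H.Walk x y)
    (hp : p.IsPath) (hj : j ∉ p.support) (hx : H.Adj j x) (hy : H.Adj j y) (hxy : x ≠ y) :
    H.IsClique {z | z = j ∨ z ∈ p.support} := by
  have hc : (SimpleGraph.Walk.cons hx (p.concat hy.symm)).IsCycle := by
    rw [SimpleGraph.Walk.cons_isCycle_iff]
    refine ⟨hp.concat hj _, ?_⟩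
    rw [SimpleGraph.Walk.edges_concat, List.concat_eq_append, List.mem_append, not_or]
    refine ⟨fun h => hj (p.fst_mem_support_of_mem_edges h), ?_⟩
    simp only [List.mem_singleton, Sym2.eq_iff]
    rintro (⟨rfl, rfl⟩ | ⟨-, rfl⟩)
    · exact hy.ne rfl
    · exact hxy rfl
  refine (hH j _ hc).subset fun z hz => ?_
  simp only [Set.mem_ofPred_eq, SimpleGraph.Walk.support_cons, List.mem_cons,
    SimpleGraph.Walk.support_concat, List.mem_append]
  rcases hz with rfl | hz
  · exact Or.inl rfl
  · exact Or.inr (Or.inl hz)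

/-- A path inside `B` between two neighbours of the outside vertex `j` closes up through `j` to a
cycle. -/
lemma IsCycleComplete.adj_of_reachable (hH : IsCycleComplete H) {j x y : N} {B : Finset N}
    (h : (restrictTo H B).Reachable x y) (hxB : x ∈ B) (hj : j ∉ B) (hx : H.Adj j x)
    (hy : H.Adj j y) (hxy : x ≠ y) : H.Adj x y := by
  obtain ⟨p, hp⟩ := h.exists_isPath
  have hs := support_subset_of_restrictTo p hxB
  refine hH.isClique_of_isPath (p.mapLe (restrictTo_le B)) (hp.mapLe _) ?_ hx hy hxy
    (Or.inr (SimpleGraph.Walk.start_mem_support _)) (Or.inr (SimpleGraph.Walk.end_mem_support _))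
    hxy
  rw [SimpleGraph.Walk.support_mapLe_eq_support]
  exact fun h => hj (hs j h)

/-- After its last visit to `j`, a walk leaves through a neighbour of `j` and stays in `A`. -/
lemma reachable_restrictTo_insert [DecidableEq N] {A : Finset N} {j x z : N} (hx : x ≠ j)
    (hj : j ∉ A) (h : (restrictTo H (insert j A)).Reachable z x) :
    (restrictTo H A).Reachable z x ∨
      ∃ k ∈ A, H.Adj j k ∧ (restrictTo H A).Reachable k x := by
  obtain ⟨p⟩ := h
  induction p with
  | nil => exact Or.inl (SimpleGraph.Reachable.refl _)
  | @cons u s t h p ih =>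
    rcases ih hx with hr | hr
    · obtain ⟨hH, hu, hs⟩ := h
      rcases eq_or_ne s j with rfl | hsj
      · exact (not_reachable_restrictTo hj hx hr).elim
      have hsA := Finset.mem_of_mem_insert_of_ne hs hsj
      rcases eq_or_ne u j with rfl | huj
      · exact Or.inr ⟨s, hsA, hH, hr⟩
      have huA := Finset.mem_of_mem_insert_of_ne hu huj
      exact Or.inl (SimpleGraph.Reachable.trans (SimpleGraph.Adj.reachable ⟨hH, huA, hsA⟩) hr)
    · exact Or.inr hr

end Restriction

/-! ### The graph-restricted game of a cycle-complete graph -/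

section ComponentSum

variable {N : Type*} [Fintype N] [DecidableEq N] {H : SimpleGraph N} {v : Finset N → ℝ}

/-- The sum of `v` over the vertex sets of the connected components of `K`. -/
noncomputable def componentSum (K : SimpleGraph N) (v : Finset N → ℝ) : ℝ :=
  blockSum K.Reachable v Finset.univ

lemma componentSum_mono {K K' : SimpleGraph N} (hv : v ∅ = 0) (hc : IsConvexGame v)
    (h : K ≤ K') : componentSum K v ≤ componentSum K' v :=
  blockSum_mono K.reachable_is_equivalence K'.reachable_is_equivalence hv hc
    (fun _ _ hij => hij.mono h) _

/-- Vertices outside `A` are isolated and contribute singletons of value zero. Summing over all of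
`N` lets different sets `A` be compared through their graphs alone. -/
lemma restrictedGame_eq_componentSum (G : SimpleGraph N) (w : Sym2 N → ℝ)
    (hv : IsZeroNormalizedGame v) (A : Finset N) :
    restrictedGame G w v A = componentSum (strongGraph G w A) v := by
  have hA : ∀ x y, (strongGraph G w A).Adj x y → x ∈ A := fun x y h =>
    ((SimpleGraph.fromEdgeSet_adj _).1 h).1.1.2 x (Sym2.mem_mk_left x y)
  have he := (strongGraph G w A).reachable_is_equivalence
  rw [componentSum, ← Finset.union_compl A, blockSum_union he disjoint_compl_right,
    blockSum_of_trivial hv he (X := Aᶜ), add_zero]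
  · rfl
  · exact fun i hi j _ hij =>
      eq_of_reachable_of_isolated hij fun z hz => Finset.mem_compl.1 hi (hA _ _ hz)
  · intro i hi j hj hij
    have := eq_of_reachable_of_isolated hij.symm fun z hz => Finset.mem_compl.1 hj (hA _ _ hz)
    exact Finset.mem_compl.1 hj (this ▸ hi)

/-- Components other than that of `j` are untouched by its arrival, so the marginal contribution is
the excess of the merged component `S` over its former pieces. -/
lemma componentSum_insert_sub {A : Finset N} {j : N} (hv : v ∅ = 0) (hj : j ∉ A)
    {S : Finset N} (hS : ∀ i, i ∈ S ↔ (restrictTo H (insert j A)).Reachable j i) :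
    componentSum (restrictTo H (insert j A)) v - componentSum (restrictTo H A) v =
      v S - blockSum (restrictTo H A).Reachable v S := by
  classical
  have hle : restrictTo H A ≤ restrictTo H (insert j A) := restrictTo_mono (Finset.subset_insert j A)
  have he := (restrictTo H A).reachable_is_equivalence
  have he' := (restrictTo H (insert j A)).reachable_is_equivalence
  have h1 : blockSum (restrictTo H (insert j A)).Reachable v Sᶜ =
      blockSum (restrictTo H A).Reachable v Sᶜ := by
    refine blockSum_congr fun i hi k hk => ⟨fun h => ?_, fun h => h.mono hle⟩
    rw [Finset.mem_compl, hS] at hk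
    have hkj : k ≠ j := by
      rintro rfl
      exact hk (SimpleGraph.Reachable.refl _)
    rcases reachable_restrictTo_insert hkj hj h with h | ⟨l, hl, hjl, hlk⟩
    · exact h
    · refine (hk (SimpleGraph.Reachable.trans (SimpleGraph.Adj.reachable ?_) (hlk.mono hle))).elim
      exact ⟨hjl, Finset.mem_insert_self _ _, Finset.mem_insert_of_mem hl⟩
  have hcross : ∀ i ∈ S, ∀ k ∈ Sᶜ, ¬ (restrictTo H (insert j A)).Reachable i k := by
    intro i hi k hk hik
    rw [Finset.mem_compl, hS] at hk
    exact hk (((hS i).1 hi).trans hik)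
  rw [componentSum, componentSum, ← Finset.union_compl S,
    blockSum_union he' disjoint_compl_right hcross,
    blockSum_union he disjoint_compl_right fun i hi k hk hik => hcross i hi k hk (hik.mono hle),
    blockSum_of_forall hv, h1]
  · ring
  · exact fun i hi k hk => ((hS i).1 hi).symm.trans ((hS k).1 hk)

/-- The graph-restricted game of a convex game is convex if the graph is cycle-complete. -/
lemma IsCycleComplete.isConvexGame_componentSum (hH : IsCycleComplete H) (hv : v ∅ = 0)
    (hc : IsConvexGame v) : IsConvexGame fun A => componentSum (restrictTo H A) v := by
  classical
  refine isConvexGame_of_marginal fun A B hAB j hj => ?_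
  have hjA : j ∉ A := fun h => hj (hAB h)
  set S := Finset.univ.filter fun i => (restrictTo H (insert j A)).Reachable j i with hS
  set T := Finset.univ.filter fun i => (restrictTo H (insert j B)).Reachable j i with hT
  have hle : restrictTo H A ≤ restrictTo H B := restrictTo_mono hAB
  have hST : S ⊆ T := fun i hi => by
    simp only [hS, hT, Finset.mem_filter, Finset.mem_univ, true_and] at hi ⊢
    exact hi.mono (restrictTo_mono (Finset.insert_subset_insert j hAB))
  rw [componentSum_insert_sub hv hjA (S := S) (by simp [hS]),
    componentSum_insert_sub hv hj (S := T) (by simp [hT])]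
  -- The larger set `B` does not merge pieces of `S`: two pieces contain neighbours `k`, `l` of `j`,
  -- and a path between them in `B` closes up through `j`, so `k` and `l` are equal or already
  -- adjacent in `A`.
  have h1 : blockSum (restrictTo H A).Reachable v S = blockSum (restrictTo H B).Reachable v S := by
    refine blockSum_congr fun x hx y hy => ⟨fun h => h.mono hle, fun h => ?_⟩
    rcases eq_or_ne x j with rfl | hxj
    · rcases eq_or_ne y x with rfl | hyx
      · exact SimpleGraph.Reachable.refl _
      · exact (not_reachable_restrictTo hj hyx h).elim
    rcases eq_or_ne y j with rfl | hyj
    · exact (not_reachable_restrictTo hj hxj h.symm).elim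
    have hS' : ∀ z ∈ S, z ≠ j → ∃ k ∈ A, H.Adj j k ∧ (restrictTo H A).Reachable k z := by
      intro z hz hzj
      exact (reachable_restrictTo_insert hzj hjA (Finset.mem_filter.1 hz).2).resolve_left
        (not_reachable_restrictTo hjA hzj)
    obtain ⟨k, hk, hjk, hkx⟩ := hS' x hx hxj
    obtain ⟨l, hl, hjl, hly⟩ := hS' y hy hyj
    refine hkx.symm.trans (SimpleGraph.Reachable.trans ?_ hly)
    rcases eq_or_ne k l with rfl | hkl
    · exact SimpleGraph.Reachable.refl _
    refine SimpleGraph.Adj.reachable ⟨?_, hk, hl⟩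
    exact hH.adj_of_reachable ((hkx.mono hle).trans (h.trans (hly.mono hle).symm)) (hAB hk) hj
      hjk hjl hkl
  rw [h1]
  exact sub_blockSum_le_sub_blockSum (restrictTo H B).reachable_is_equivalence hv hc hST

end ComponentSum

/-! ### Edges of non-minimal weight -/

section Weights

variable {N : Type*} {G : SimpleGraph N} {w : Sym2 N → ℝ}

lemma mem_edgesIn {A : Finset N} {x y : N} :
    s(x, y) ∈ edgesIn G A ↔ G.Adj x y ∧ x ∈ A ∧ y ∈ A := by
  simp [edgesIn]

lemma strongGraph_adj {A : Finset N} {x y : N} :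
    (strongGraph G w A).Adj x y ↔
      G.Adj x y ∧ x ∈ A ∧ y ∈ A ∧ ∃ a ∈ A, ∃ b ∈ A, G.Adj a b ∧ w s(a, b) < w s(x, y) := by
  rw [strongGraph, SimpleGraph.fromEdgeSet_adj, Set.mem_sdiff, mem_edgesIn, minEdges,
    Set.mem_ofPred_eq, mem_edgesIn]
  constructor
  · rintro ⟨⟨⟨h, hx, hy⟩, hn⟩, -⟩
    refine ⟨h, hx, hy, ?_⟩
    by_contra! hcon
    refine hn ⟨⟨h, hx, hy⟩, fun e => ?_⟩
    induction e with
    | h a b =>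
      rw [mem_edgesIn]
      exact fun hab => hcon a hab.2.1 b hab.2.2 hab.1
  · rintro ⟨h, hx, hy, a, ha, b, hb, hab, hlt⟩
    refine ⟨⟨⟨h, hx, hy⟩, fun hn => ?_⟩, h.ne⟩
    exact (hn.2 s(a, b) (mem_edgesIn.2 ⟨hab, ha, hb⟩)).not_gt hlt

lemma strongGraph_mono {A B : Finset N} (h : A ⊆ B) : strongGraph G w A ≤ strongGraph G w B := by
  intro x y
  rw [strongGraph_adj, strongGraph_adj]
  rintro ⟨hxy, hx, hy, a, ha, b, hb, hab, hlt⟩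
  exact ⟨hxy, h hx, h hy, a, h ha, b, h hb, hab, hlt⟩

lemma mem_weightClass {σ : ℝ} {x y : N} :
    s(x, y) ∈ weightClass G w σ ↔ G.Adj x y ∧ w s(x, y) = σ := Iff.rfl

lemma deleteEdges_weightClass_adj {σ : ℝ} {x y : N} :
    (G.deleteEdges (weightClass G w σ)).Adj x y ↔ G.Adj x y ∧ w s(x, y) ≠ σ := by
  rw [SimpleGraph.deleteEdges_adj, mem_weightClass]
  tauto

lemma isLinkedBy_iff {x y z : N} {e : Sym2 N} :
    IsLinkedBy s(x, y) z e ↔ e = s(x, z) ∨ e = s(y, z) := by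
  simp [IsLinkedBy]

variable {σ₁ σ₂ σ₃ : ℝ}

lemma weight_cases (hw : w '' G.edgeSet = {σ₁, σ₂, σ₃}) {x y : N} (h : G.Adj x y) :
    w s(x, y) = σ₁ ∨ w s(x, y) = σ₂ ∨ w s(x, y) = σ₃ := by
  have : w s(x, y) ∈ w '' G.edgeSet := ⟨s(x, y), h, rfl⟩
  rw [hw] at this
  simpa using this

end Weights

/-! ### Sufficiency of the conditions -/

namespace StructureConditions

variable {N : Type*} {G : SimpleGraph N} {w : Sym2 N → ℝ} {σ₁ σ₂ σ₃ : ℝ} {v₁ v₂ : N}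

lemma mem_min (h : StructureConditions G w σ₁ σ₂ σ₃ v₁ v₂) :
    G.Adj v₁ v₂ ∧ w s(v₁, v₂) = σ₁ := by
  rw [← mem_weightClass, h.unique_min_edge]
  rfl

lemma weight_eq_min_iff (h : StructureConditions G w σ₁ σ₂ σ₃ v₁ v₂) {x y : N} (hxy : G.Adj x y) :
    w s(x, y) = σ₁ ↔ s(x, y) = s(v₁, v₂) := by
  have : s(x, y) ∈ weightClass G w σ₁ ↔ s(x, y) = s(v₁, v₂) := by
    rw [h.unique_min_edge, Set.mem_singleton_iff]
  rw [← this, mem_weightClass]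
  simp [hxy]

lemma deleteEdges_adj (h : StructureConditions G w σ₁ σ₂ σ₃ v₁ v₂) {x y : N} :
    (G.deleteEdges (weightClass G w σ₁)).Adj x y ↔ G.Adj x y ∧ s(x, y) ≠ s(v₁, v₂) := by
  rw [SimpleGraph.deleteEdges_adj, h.unique_min_edge, Set.mem_singleton_iff]

lemma middle (h : StructureConditions G w σ₁ σ₂ σ₃ v₁ v₂) {x y : N} (hxy : G.Adj x y)
    (hσ : w s(x, y) = σ₂) : v₂ = x ∨ v₂ = y := by
  simpa using h.middle_incident _ (mem_weightClass.2 ⟨hxy, hσ⟩)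

lemma linked (h : StructureConditions G w σ₁ σ₂ σ₃ v₁ v₂) {x y : N} (hxy : G.Adj x y)
    (hσ : w s(x, y) = σ₃) : v₁ = x ∨ v₁ = y ∨
      (G.Adj x v₂ ∧ w s(x, v₂) = σ₂) ∨ (G.Adj y v₂ ∧ w s(y, v₂) = σ₂) := by
  rcases h.max_linked _ (mem_weightClass.2 ⟨hxy, hσ⟩) with h1 | ⟨e, he, h1⟩
  · rw [isLinkedBy_iff, Sym2.congr_left, Sym2.congr_left] at h1
    tauto
  · rw [isLinkedBy_iff] at h1
    rcases h1 with rfl | rfl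
    · exact Or.inr (Or.inr (Or.inl he))
    · exact Or.inr (Or.inr (Or.inr he))

/-- An edge linking such an edge to its own end `v₂` would be that edge itself, whose weight is then
smaller than `σ₃`, or a loop. -/
lemma max_not_incident (h : StructureConditions G w σ₁ σ₂ σ₃ v₁ v₂) (h₁₂ : σ₁ < σ₂)
    (h₂₃ : σ₂ < σ₃) {x : N} (hx : G.Adj x v₂) : w s(x, v₂) ≠ σ₃ := by
  intro hσ
  have h1 := h.mem_min
  rcases h.linked hx hσ with rfl | rfl | h2 | h2
  · linarith [h1.2]
  · exact h1.1.ne rfl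
  · linarith [h2.2]
  · exact h2.1.ne rfl

open scoped Classical in
/-- The vertices spanning the graph of non-minimal edges of `A`, for the edge `s(v₁, v₂)`. -/
noncomputable def core (v₁ v₂ : N) (A : Finset N) : Finset N :=
  A.filter fun x => v₂ ∈ A ∧ (x = v₂ → v₁ ∈ A)

/-- Without `v₂`, all edges in `A` have weight `σ₃`, so all are minimal. With `v₁` and `v₂`, only
`e₁` is minimal. With `v₂` but not `v₁`, the edges at `v₂` are those of weight `σ₂`; any edge of
weight `σ₃` is linked to `v₂` by one of them, so exactly the edges at `v₂` are discarded. -/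
lemma strongGraph_eq (h : StructureConditions G w σ₁ σ₂ σ₃ v₁ v₂) (h₁₂ : σ₁ < σ₂)
    (h₂₃ : σ₂ < σ₃) (hw : w '' G.edgeSet = {σ₁, σ₂, σ₃}) (A : Finset N) :
    strongGraph G w A = restrictTo (G.deleteEdges (weightClass G w σ₁)) (core v₁ v₂ A) := by
  ext x y
  rw [strongGraph_adj]
  simp only [restrictTo, core, Finset.mem_filter, deleteEdges_weightClass_adj]
  obtain ⟨h12, hσ⟩ := h.mem_min
  constructor
  · rintro ⟨hxy, hx, hy, a, ha, b, hb, hab, hlt⟩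
    have hne : w s(x, y) ≠ σ₁ := by
      rcases weight_cases hw hab with h1 | h1 | h1 <;> linarith
    have hmin : v₁ ∉ A → w s(x, y) = σ₃ ∧ w s(a, b) = σ₂ := by
      intro h1
      have : w s(a, b) ≠ σ₁ := by
        rw [Ne, h.weight_eq_min_iff hab, Sym2.eq_iff]
        rintro (⟨rfl, rfl⟩ | ⟨rfl, rfl⟩) <;> exact h1 ‹_›
      rcases weight_cases hw hab with h2 | h2 | h2 <;>
        rcases weight_cases hw hxy with h3 | h3 | h3 <;>
        first | exact (this h2).elim | exact (hne h3).elim | exact ⟨h3, h2⟩ | linarith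
    have h2A : v₂ ∈ A := by
      by_contra h2
      have hab' : w s(a, b) = σ₃ := by
        rcases weight_cases hw hab with h1 | h1 | h1
        · rw [h.weight_eq_min_iff hab, Sym2.eq_iff] at h1
          rcases h1 with ⟨rfl, rfl⟩ | ⟨rfl, rfl⟩ <;> exact (h2 ‹_›).elim
        · rcases h.middle hab h1 with rfl | rfl <;> exact (h2 ‹_›).elim
        · exact h1
      rcases weight_cases hw hxy with h3 | h3 | h3 <;> linarith
    have hmax : ∀ {x y}, G.Adj x y → w s(x, y) = σ₃ → x ≠ v₂ := by
      rintro x y hxy h3 rfl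
      rw [Sym2.eq_swap] at h3
      exact h.max_not_incident h₁₂ h₂₃ hxy.symm h3
    refine ⟨⟨hxy, hne⟩, ⟨hx, h2A, fun hx2 => ?_⟩, hy, h2A, fun hy2 => ?_⟩
    · by_contra h1
      exact hmax hxy (hmin h1).1 hx2
    · by_contra h1
      refine hmax hxy.symm ?_ hy2
      rw [Sym2.eq_swap]
      exact (hmin h1).1
  · rintro ⟨⟨hxy, hne⟩, ⟨hx, h2A, hx2⟩, hy, -, hy2⟩
    refine ⟨hxy, hx, hy, ?_⟩
    by_cases h1 : v₁ ∈ A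
    · refine ⟨v₁, h1, v₂, h2A, h12, ?_⟩
      rcases weight_cases hw hxy with h3 | h3 | h3
      · exact (hne h3).elim
      · linarith
      · linarith
    · have h3 : w s(x, y) = σ₃ := by
        rcases weight_cases hw hxy with h3 | h3 | h3
        · exact (hne h3).elim
        · rcases h.middle hxy h3 with rfl | rfl
          · exact (h1 (hx2 rfl)).elim
          · exact (h1 (hy2 rfl)).elim
        · exact h3
      rcases h.linked hxy h3 with rfl | rfl | h4 | h4
      · exact (h1 hx).elim
      · exact (h1 hy).elim
      · exact ⟨x, hx, v₂, h2A, h4.1, by linarith [h4.2]⟩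
      · exact ⟨y, hy, v₂, h2A, h4.1, by linarith [h4.2]⟩

/-- The structure conditions imply inheritance of convexity. -/
lemma inheritsConvexity [Fintype N] [DecidableEq N]
    (h : StructureConditions G w σ₁ σ₂ σ₃ v₁ v₂) (h₁₂ : σ₁ < σ₂)
    (h₂₃ : σ₂ < σ₃) (hw : w '' G.edgeSet = {σ₁, σ₂, σ₃}) : InheritsConvexity G w := by
  intro v hv hc A B
  have hmono : ∀ A B, A ⊆ B → restrictedGame G w v A ≤ restrictedGame G w v B := by
    intro A B hAB
    rw [restrictedGame_eq_componentSum G w hv, restrictedGame_eq_componentSum G w hv]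
    exact componentSum_mono hv.empty hc (strongGraph_mono hAB)
  have heq : ∀ A, restrictedGame G w v A =
      componentSum (restrictTo (G.deleteEdges (weightClass G w σ₁)) (core v₁ v₂ A)) v := by
    intro A
    rw [restrictedGame_eq_componentSum G w hv, h.strongGraph_eq h₁₂ h₂₃ hw]
  have hcore : ∀ C, v₂ ∉ C → core v₁ v₂ C = ∅ := by
    intro C hC
    simp [core, hC]
  -- If a set misses `v₂`, its core and that of `A ∩ B` are both empty, and monotonicity handles the
  -- other two terms.
  by_cases hA : v₂ ∈ A
  · by_cases hB : v₂ ∈ B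
    · have h1 := h.cycleComplete.isConvexGame_componentSum hv.empty hc
        (core v₁ v₂ A) (core v₁ v₂ B)
      have h2 : core v₁ v₂ A ∪ core v₁ v₂ B = core v₁ v₂ (A ∪ B) := by
        ext x
        simp only [core, Finset.mem_filter, Finset.mem_union, hA, hB, true_and, true_or]
        by_cases hx : x = v₂
        · subst hx; simp [hA, hB]
        · simp [hx]
      have h3 : core v₁ v₂ A ∩ core v₁ v₂ B = core v₁ v₂ (A ∩ B) := by
        ext x
        simp only [core, Finset.mem_filter, Finset.mem_inter, hA, hB, true_and]
        tauto
      simp only [h2, h3] at h1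
      simpa only [heq] using h1
    · have h1 := hmono A (A ∪ B) Finset.subset_union_left
      have h2 : restrictedGame G w v B = restrictedGame G w v (A ∩ B) := by
        rw [heq, heq, hcore _ hB, hcore _ fun h => hB (Finset.mem_inter.1 h).2]
      linarith
  · have h1 := hmono B (A ∪ B) Finset.subset_union_right
    have h2 : restrictedGame G w v A = restrictedGame G w v (A ∩ B) := by
      rw [heq, heq, hcore _ hA, hcore _ fun h => hA (Finset.mem_inter.1 h).1]
    linarith

end StructureConditions

/-! ### Consequences of inheritance for unanimity games of pairs -/

section Unanimity

variable {N : Type*} [DecidableEq N] {G : SimpleGraph N} {w : Sym2 N → ℝ}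

/-- The unanimity game of the pair `{x, y}`. -/
def pairGame (x y : N) (A : Finset N) : ℝ := if x ∈ A ∧ y ∈ A then 1 else 0

lemma isZeroNormalizedGame_pairGame {x y : N} (hxy : x ≠ y) :
    IsZeroNormalizedGame (pairGame x y) where
  empty := by simp [pairGame]
  singleton i := by
    simp only [pairGame, Finset.mem_singleton]
    rw [if_neg]
    rintro ⟨rfl, rfl⟩
    exact hxy rfl

lemma isConvexGame_pairGame (x y : N) : IsConvexGame (pairGame x y) := by
  intro A B
  simp only [pairGame, Finset.mem_union, Finset.mem_inter]
  by_cases hxA : x ∈ A <;> by_cases hyA : y ∈ A <;> by_cases hxB : x ∈ B <;>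
    by_cases hyB : y ∈ B <;> simp [hxA, hyA, hxB, hyB]

lemma strongGraph_mem_of_reachable {A : Finset N} {x y : N} (hxy : x ≠ y)
    (h : (strongGraph G w A).Reachable x y) : x ∈ A := by
  by_contra hx
  exact hxy (eq_of_reachable_of_isolated h fun z hz => hx (strongGraph_adj.1 hz).2.1)

open scoped Classical in
lemma restrictedGame_pairGame {x y : N} (hxy : x ≠ y) (A : Finset N) :
    restrictedGame G w (pairGame x y) A =
      if (strongGraph G w A).Reachable x y then 1 else 0 := by
  have hmem : ∀ i, (x ∈ A.filter fun j => (strongGraph G w A).Reachable i j) →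
      (A.filter fun j => (strongGraph G w A).Reachable i j) =
        A.filter fun j => (strongGraph G w A).Reachable x j := by
    intro i hi
    have hi := (Finset.mem_filter.1 hi).2
    exact Finset.filter_congr fun j _ => ⟨hi.symm.trans, hi.trans⟩
  split_ifs with h
  · have hx := strongGraph_mem_of_reachable hxy h
    have hy := strongGraph_mem_of_reachable hxy.symm h.symm
    rw [restrictedGame, Finset.sum_eq_single
      (A.filter fun j => (strongGraph G w A).Reachable x j)]
    · rw [pairGame, if_pos]
      exact ⟨Finset.mem_filter.2 ⟨hx, SimpleGraph.Reachable.refl _⟩, Finset.mem_filter.2 ⟨hy, h⟩⟩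
    · intro F hF hne
      obtain ⟨i, -, rfl⟩ := Finset.mem_image.1 hF
      exact if_neg fun hi => hne (hmem i hi.1)
    · exact fun hF => (hF (Finset.mem_image_of_mem _ hx)).elim
  · refine Finset.sum_eq_zero fun F hF => ?_
    obtain ⟨i, -, rfl⟩ := Finset.mem_image.1 hF
    refine if_neg fun hi => h ?_
    have hy := hi.2
    rw [hmem i hi.1] at hy
    exact (Finset.mem_filter.1 hy).2

/-- The restricted pair game is the 0–1 indicator of connection between `x` and `y`. If it is 1 at
`A` and `B`, convexity forces it to be 1 at `A ∩ B`. -/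
lemma InheritsConvexity.reachable_inter (h : InheritsConvexity G w) {x y : N} {A B : Finset N}
    (hA : (strongGraph G w A).Reachable x y) (hB : (strongGraph G w B).Reachable x y) :
    (strongGraph G w (A ∩ B)).Reachable x y := by
  rcases eq_or_ne x y with rfl | hxy
  · exact SimpleGraph.Reachable.refl _
  have h1 := h _ (isZeroNormalizedGame_pairGame hxy) (isConvexGame_pairGame x y) A B
  simp only [restrictedGame_pairGame hxy, if_pos hA, if_pos hB] at h1
  by_contra hcon
  rw [if_neg hcon] at h1
  split_ifs at h1 <;> linarith

lemma InheritsConvexity.reachable_of_lt (h : InheritsConvexity G w) {x y a b c d : N}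
    (hxy : G.Adj x y) (hab : G.Adj a b) (hcd : G.Adj c d) (h1 : w s(a, b) < w s(x, y))
    (h2 : w s(c, d) < w s(x, y)) :
    (strongGraph G w (({x, y, a, b} : Finset N) ∩ {x, y, c, d})).Reachable x y := by
  refine h.reachable_inter (SimpleGraph.Adj.reachable ?_) (SimpleGraph.Adj.reachable ?_)
  · exact strongGraph_adj.2 ⟨hxy, by simp, by simp, a, by simp, b, by simp, hab, h1⟩
  · exact strongGraph_adj.2 ⟨hxy, by simp, by simp, c, by simp, d, by simp, hcd, h2⟩

/-- Two edges of smaller weight than `e` share a vertex outside `e`. -/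
lemma InheritsConvexity.exists_common_vertex (h : InheritsConvexity G w) {e f g : Sym2 N}
    (he : e ∈ G.edgeSet) (hf : f ∈ G.edgeSet) (hg : g ∈ G.edgeSet) (h1 : w f < w e)
    (h2 : w g < w e) : ∃ z, z ∈ f ∧ z ∈ g ∧ z ∉ e := by
  induction e with | h x y =>
  induction f with | h a b =>
  induction g with | h c d =>
  by_contra! hcon
  have hr := h.reachable_of_lt he hf hg h1 h2
  have he' : G.Adj x y := he
  -- Otherwise the intersection is `{x, y}`, whose only edge has minimum weight and is discarded,
  -- leaving `x` isolated.
  have hsub : ∀ z ∈ ({x, y, a, b} : Finset N) ∩ {x, y, c, d}, z = x ∨ z = y := by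
    intro z hz
    have := hcon z
    simp only [Sym2.mem_iff, Finset.mem_inter, Finset.mem_insert, Finset.mem_singleton] at *
    tauto
  refine he'.ne (eq_of_reachable_of_isolated hr fun z hz => ?_)
  obtain ⟨hxz, -, hz, p, hp, q, hq, hpq, hlt⟩ := strongGraph_adj.1 hz
  have e1 : s(x, z) = s(x, y) := by
    rcases hsub z hz with rfl | rfl
    · exact (hxz.ne rfl).elim
    · rfl
  have e2 : s(p, q) = s(x, y) := by
    rcases hsub p hp with rfl | rfl <;> rcases hsub q hq with rfl | rfl
    · exact (hpq.ne rfl).elim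
    · rfl
    · exact Sym2.eq_swap
    · exact (hpq.ne rfl).elim
  rw [e1, e2] at hlt
  exact hlt.false

end Unanimity

/-! ### Pairwise intersecting edges: star or triangle -/

section Star

variable {N : Type*} {G : SimpleGraph N}

lemma mem_of_connected (hG : G.Connected) {S : Set N} {x : N} (hx : x ∈ S)
    (hS : ∀ a ∈ S, ∀ b, G.Adj a b → b ∈ S) (y : N) : y ∈ S := by
  obtain ⟨p⟩ := hG x y
  induction p with
  | nil => exact hx
  | cons h p ih => exact ih (hS _ hx _ h)

/-- If a connected graph has an edge outside a set `L` with two members, and the members of `L` meet pairwise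
outside each of the edges not in `L`, then they have a common vertex. -/
lemma exists_star_center (hG : G.Connected) {L : Set (Sym2 N)}
    {f g e₀ : Sym2 N} (hf : f ∈ L) (hg : g ∈ L) (hfg : f ≠ g) (he₀ : e₀ ∈ G.edgeSet)
    (he₀L : e₀ ∉ L)
    (h : ∀ e ∈ G.edgeSet, e ∉ L → ∀ a ∈ L, ∀ b ∈ L, ∃ z, z ∈ a ∧ z ∈ b ∧ z ∉ e) :
    ∃ c, ∀ e ∈ L, c ∈ e := by
  obtain ⟨c, hcf, hcg, -⟩ := h _ he₀ he₀L _ hf _ hg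
  refine ⟨c, fun k hk => ?_⟩
  by_contra hck
  obtain ⟨a, rfl⟩ := hcf
  obtain ⟨b, rfl⟩ := hcg
  have hab : a ≠ b := fun hab => hfg (hab ▸ rfl)
  obtain ⟨a', ha1, ha2, -⟩ := h _ he₀ he₀L _ hf _ hk
  obtain ⟨b', hb1, hb2, -⟩ := h _ he₀ he₀L _ hg _ hk
  have haa : a' = a := by
    rcases Sym2.mem_iff.1 ha1 with rfl | rfl
    · exact (hck ha2).elim
    · rfl
  have hbb : b' = b := by
    rcases Sym2.mem_iff.1 hb1 with rfl | rfl
    · exact (hck hb2).elim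
    · rfl
  subst haa hbb
  have hk' : k = s(a', b') := (Sym2.mem_and_mem_iff hab).1 ⟨ha2, hb2⟩
  subst hk'
  have hca : c ≠ a' := fun h => hck (h ▸ ha2)
  have hcb : c ≠ b' := fun h => hck (h ▸ hb2)
  -- The edges `f`, `g`, `k` now form a triangle. Each of its vertices is the only meeting point of
  -- two of them, so edges outside `L` avoid it; edges in `L` that touch it have both ends in it. By
  -- connectedness the triangle is everything, which leaves no place for `e₀`.
  have hout : ∀ e ∈ G.edgeSet, e ∉ L → c ∉ e ∧ a' ∉ e ∧ b' ∉ e := by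
    intro e he heL
    have h1 := h e he heL _ hf _ hg
    have h2 := h e he heL _ hf _ hk
    have h3 := h e he heL _ hg _ hk
    simp only [Sym2.mem_iff] at h1 h2 h3
    grind
  have hS := mem_of_connected hG (S := {c, a', b'}) (x := c) (by simp) (by
    intro p hp q hpq
    by_cases hpqL : s(p, q) ∈ L
    · have h1 := h _ he₀ he₀L _ hpqL _ hf
      have h2 := h _ he₀ he₀L _ hpqL _ hg
      have h3 := h _ he₀ he₀L _ hpqL _ hk
      simp only [Sym2.mem_iff] at h1 h2 h3
      simp only [Set.mem_insert_iff, Set.mem_singleton_iff] at hp ⊢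
      grind
    · have h1 := hout _ hpq hpqL
      simp only [Sym2.mem_iff] at h1
      simp only [Set.mem_insert_iff, Set.mem_singleton_iff] at hp
      grind)
  induction e₀ with
  | h p q =>
    have h1 := hout _ he₀ he₀L
    have h2 := hS p
    simp only [Sym2.mem_iff] at h1
    simp only [Set.mem_insert_iff, Set.mem_singleton_iff] at h2
    grind

end Star

/-! ### Necessity of conditions 1, 2, 3 and 5 -/

section Necessity

variable {N : Type*} {G : SimpleGraph N} {w : Sym2 N → ℝ} {σ₁ σ₂ σ₃ : ℝ}

/-- The edges lighter than `σ₃` form a star, and distinct edges of it meet only in its centre `c`.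
Two edges of weight `σ₁` would have to meet outside an edge of weight `σ₂`, which contains `c`;
likewise `f` and `g` meet outside every edge of weight `σ₃`, which therefore misses `c`. -/
lemma InheritsConvexity.exists_center [DecidableEq N] (h : InheritsConvexity G w)
    (hG : G.Connected) (h₁₂ : σ₁ < σ₂) (h₂₃ : σ₂ < σ₃) (hw : w '' G.edgeSet = {σ₁, σ₂, σ₃}) :
    ∃ v₁ v₂ : N, weightClass G w σ₁ = {s(v₁, v₂)} ∧ (∀ e ∈ weightClass G w σ₂, v₂ ∈ e) ∧
      ∀ e ∈ weightClass G w σ₃, v₂ ∉ e := by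
  have hex : ∀ σ ∈ ({σ₁, σ₂, σ₃} : Set ℝ), ∃ e ∈ G.edgeSet, w e = σ := fun σ hσ => by
    rwa [← hw] at hσ
  obtain ⟨f, hf, hfσ⟩ := hex σ₁ (by simp)
  obtain ⟨g, hg, hgσ⟩ := hex σ₂ (by simp)
  obtain ⟨e₀, he₀, he₀σ⟩ := hex σ₃ (by simp)
  have hfg : f ≠ g := by
    rintro rfl
    linarith
  have hle : ∀ e ∈ G.edgeSet, w e ≤ σ₃ := by
    intro e he
    have : w e ∈ w '' G.edgeSet := ⟨e, he, rfl⟩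
    rw [hw] at this
    simp only [Set.mem_insert_iff, Set.mem_singleton_iff] at this
    rcases this with h | h | h <;> linarith
  obtain ⟨c, hc⟩ := exists_star_center hG (L := {e | e ∈ G.edgeSet ∧ w e < σ₃})
    (f := f) (g := g) (e₀ := e₀) ⟨hf, by linarith⟩ ⟨hg, by linarith⟩ hfg he₀
    (fun h => by linarith [h.2]) (by
      intro e he heL a ha b hb
      have hσ : w e = σ₃ := (hle e he).antisymm (not_lt.1 fun h => heL ⟨he, h⟩)
      exact h.exists_common_vertex he ha.1 hb.1 (hσ ▸ ha.2) (hσ ▸ hb.2))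
  have huniq : ∀ k l : Sym2 N, k ≠ l → c ∈ k → c ∈ l → ∀ z, z ∈ k → z ∈ l → z = c := by
    intro k l hkl hck hcl z hzk hzl
    by_contra hzc
    exact hkl (((Sym2.mem_and_mem_iff hzc).1 ⟨hzk, hck⟩).trans
      ((Sym2.mem_and_mem_iff hzc).1 ⟨hzl, hcl⟩).symm)
  have hcf : c ∈ f := hc f ⟨hf, by linarith⟩
  have hcg : c ∈ g := hc g ⟨hg, by linarith⟩
  refine ⟨Sym2.Mem.other hcf, c, ?_, fun e he => hc e ⟨he.1, by linarith [he.2]⟩, ?_⟩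
  · rw [Sym2.eq_swap, Sym2.other_spec hcf]
    refine Set.eq_singleton_iff_unique_mem.2 ⟨⟨hf, hfσ⟩, fun k hk => ?_⟩
    by_contra hkf
    obtain ⟨z, hzf, hzk, hzg⟩ := h.exists_common_vertex hg hf hk.1 (by linarith)
      (by linarith [hk.2])
    exact hzg (huniq k f hkf (hc k ⟨hk.1, by linarith [hk.2]⟩) hcf z hzk hzf ▸ hcg)
  · intro e he hce
    obtain ⟨z, hzf, hzg, hze⟩ := h.exists_common_vertex he.1 hf hg (by linarith [he.2])
      (by linarith [he.2])
    exact hze (huniq f g hfg hcf hcg z hzf hzg ▸ hce)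

lemma exists_adj_of_reachable {K : SimpleGraph N} {x y : N} (h : K.Reachable x y) (hxy : x ≠ y) :
    ∃ z, K.Adj x z := by
  by_contra! hcon
  exact hxy (eq_of_reachable_of_isolated h hcon)

lemma InheritsConvexity.max_linked [DecidableEq N] (h : InheritsConvexity G w) (h₁₂ : σ₁ < σ₂)
    (h₂₃ : σ₂ < σ₃) (hw : w '' G.edgeSet = {σ₁, σ₂, σ₃}) {v₁ v₂ : N}
    (hmin : weightClass G w σ₁ = {s(v₁, v₂)}) (hmid : ∀ e ∈ weightClass G w σ₂, v₂ ∈ e)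
    (hmax : ∀ e ∈ weightClass G w σ₃, v₂ ∉ e) :
    ∀ e ∈ weightClass G w σ₃,
      IsLinkedBy e v₂ s(v₁, v₂) ∨ ∃ e' ∈ weightClass G w σ₂, IsLinkedBy e v₂ e' := by
  intro e he
  have hout := hmax e he
  induction e with | h x y =>
  obtain ⟨e₂, he₂, hσ₂⟩ : σ₂ ∈ w '' G.edgeSet := by simp [hw]
  obtain ⟨z, rfl⟩ := hmid e₂ ⟨he₂, hσ₂⟩
  have h1 : G.Adj v₁ v₂ ∧ w s(v₁, v₂) = σ₁ := by
    rw [← mem_weightClass, hmin]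
    rfl
  obtain ⟨hxy, hσ₃⟩ := he
  by_contra hcon
  simp only [isLinkedBy_iff, not_or, not_exists, not_and, Sym2.congr_left] at hcon
  obtain ⟨⟨hx1, hy1⟩, h2⟩ := hcon
  simp only [Sym2.mem_iff, not_or] at hout
  have hzx : z ≠ x := by
    rintro rfl
    exact (h2 _ ⟨he₂, hσ₂⟩).1 Sym2.eq_swap
  have hzy : z ≠ y := by
    rintro rfl
    exact (h2 _ ⟨he₂, hσ₂⟩).2 Sym2.eq_swap
  -- Both `e₁` and the edge `s(v₂, z)` are lighter than `s(x, y)`. The two sets meet in `{x, y,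
  -- v₂}`, where unlinkedness leaves `s(x, y)` as the only edge.
  have hr := h.reachable_of_lt hxy h1.1 he₂ (by linarith) (by linarith)
  have h12 := h1.1.ne
  have hA : ({x, y, v₁, v₂} : Finset N) ∩ {x, y, v₂, z} ⊆ {x, y, v₂} := by
    intro a ha
    simp only [Finset.mem_inter, Finset.mem_insert, Finset.mem_singleton] at ha ⊢
    grind
  have hno : ∀ u, u = x ∨ u = y → ¬ G.Adj u v₂ := by
    intro u hu huv
    have h3 : w s(u, v₂) ≠ σ₂ := fun h3 => by
      rcases hu with rfl | rfl
      · exact (h2 _ ⟨huv, h3⟩).1 rfl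
      · exact (h2 _ ⟨huv, h3⟩).2 rfl
    have h4 : w s(u, v₂) ≠ σ₃ := fun h4 => hmax _ ⟨huv, h4⟩ (by simp)
    have h5 : w s(u, v₂) ≠ σ₁ := fun h5 => by
      have : s(u, v₂) ∈ weightClass G w σ₁ := ⟨huv, h5⟩
      rw [hmin, Set.mem_singleton_iff, Sym2.congr_left] at this
      grind
    rcases weight_cases hw huv with h | h | h
    · exact h5 h
    · exact h3 h
    · exact h4 h
  obtain ⟨t, ht⟩ := exists_adj_of_reachable hr hxy.ne
  obtain ⟨-, -, -, a, ha, b, hb, hab, hlt⟩ := strongGraph_adj.1 ht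
  obtain ⟨hxt, -, htA, -⟩ := strongGraph_adj.1 ht
  have hedge : ∀ a b, a ∈ ({x, y, v₂} : Finset N) → b ∈ ({x, y, v₂} : Finset N) → G.Adj a b →
      s(a, b) = s(x, y) := by
    intro a b ha hb hab
    have ha2 := hno a
    have hb2 := hno b
    have hne := hab.ne
    have hab' := hab.symm
    simp only [Finset.mem_insert, Finset.mem_singleton] at ha hb
    rw [Sym2.eq_iff]
    grind
  rw [hedge a b (hA ha) (hA hb) hab, hedge x t (by simp) (hA htA) hxt] at hlt
  exact hlt.false

/-- Two vertices of a cycle are joined by two walks in it that have only their ends in common. -/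
lemma exists_arcs [DecidableEq N] {H : SimpleGraph N} {u x y : N} {p : H.Walk u u} (hp : p.IsCycle)
    (hx : x ∈ p.support) (hy : y ∈ p.support) :
    ∃ P Q : H.Walk x y, (∀ z ∈ P.support, z ∈ p.support) ∧ (∀ z ∈ Q.support, z ∈ p.support) ∧
      ∀ z, z ∈ P.support → z ∈ Q.support → z = x ∨ z = y := by
  have hq : (p.rotate x hx).IsCycle := by simpa using hp
  have hy' : y ∈ (p.rotate x hx).support := by simpa using hy
  have hs : ∀ z ∈ (p.rotate x hx).support, z ∈ p.support := by simp
  generalize p.rotate x hx = q at hq hy' hs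
  refine ⟨q.takeUntil y hy', (q.dropUntil y hy').reverse,
    fun z hz => hs z (q.support_takeUntil_subset_support hy' hz), fun z hz => hs z ?_, ?_⟩
  · rw [SimpleGraph.Walk.support_reverse, List.mem_reverse] at hz
    exact q.support_dropUntil_subset_support hy' hz
  · intro z hz1 hz2
    rw [SimpleGraph.Walk.support_reverse, List.mem_reverse] at hz2
    by_contra! hcon
    have hn := hq.support_nodup
    rw [← q.take_spec hy', SimpleGraph.Walk.tail_support_append, List.nodup_append'] at hn
    exact hn.2.2 (((SimpleGraph.Walk.mem_support_iff _).1 hz1).resolve_left hcon.1)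
      (((SimpleGraph.Walk.mem_support_iff _).1 hz2).resolve_left hcon.2)

lemma reachable_of_walk {H K : SimpleGraph N} {x y : N} (p : H.Walk x y)
    (h : ∀ a ∈ p.support, ∀ b ∈ p.support, H.Adj a b → K.Adj a b) : K.Reachable x y := by
  induction p with
  | nil => exact SimpleGraph.Reachable.refl _
  | cons hab p ih =>
    refine SimpleGraph.Reachable.trans (SimpleGraph.Adj.reachable (h _ (by simp) _ (by simp) hab))
      (ih fun a ha b hb => h a ?_ b ?_)
    · simp [ha]
    · simp [hb]

/-- Adding `v₁` and `v₂` to either arc between `x` and `y` makes all its edges non-minimal, so `x`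
and `y` are connected within `{x, y, v₁, v₂}`. This gives adjacency if one of them is `v₁` or `v₂`.
Otherwise intersecting with a third set, an arc avoiding both together with `v₂`, removes `v₁` as
well. -/
lemma InheritsConvexity.isCycleComplete [DecidableEq N] (h : InheritsConvexity G w) (h₁₂ : σ₁ < σ₂)
    (h₂₃ : σ₂ < σ₃) (hw : w '' G.edgeSet = {σ₁, σ₂, σ₃}) {v₁ v₂ : N}
    (hmin : weightClass G w σ₁ = {s(v₁, v₂)}) (hmid : ∀ e ∈ weightClass G w σ₂, v₂ ∈ e)
    (hmax : ∀ e ∈ weightClass G w σ₃, v₂ ∉ e)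
    (hlink : ∀ e ∈ weightClass G w σ₃,
      IsLinkedBy e v₂ s(v₁, v₂) ∨ ∃ e' ∈ weightClass G w σ₂, IsLinkedBy e v₂ e') :
    IsCycleComplete (G.deleteEdges (weightClass G w σ₁)) := by
  have hHadj : ∀ {x y}, (G.deleteEdges (weightClass G w σ₁)).Adj x y ↔
      G.Adj x y ∧ w s(x, y) ≠ σ₁ := deleteEdges_weightClass_adj
  generalize G.deleteEdges (weightClass G w σ₁) = H at hHadj ⊢
  intro u p hp
  have h1 : G.Adj v₁ v₂ ∧ w s(v₁, v₂) = σ₁ := by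
    rw [← mem_weightClass, hmin]
    rfl
  have hH12 : ¬ H.Adj v₁ v₂ := fun h2 => (hHadj.1 h2).2 h1.2
  -- connection within the two ends and the minimal edge
  have hshort : ∀ x ∈ p.support, ∀ y ∈ p.support, x ≠ y →
      (strongGraph G w {x, y, v₁, v₂}).Reachable x y := by
    intro x hx y hy hxy
    obtain ⟨P, Q, -, -, hPQ⟩ := exists_arcs hp hx hy
    have hwalk : ∀ P : H.Walk x y,
        (strongGraph G w (P.support.toFinset ∪ {v₁, v₂})).Reachable x y := by
      refine fun P => reachable_of_walk P fun a ha b hb hab => strongGraph_adj.2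
        ⟨(hHadj.1 hab).1, by simp [ha], by simp [hb], v₁, by simp, v₂, by simp, h1.1, ?_⟩
      rw [h1.2]
      rcases weight_cases hw (hHadj.1 hab).1 with h2 | h2 | h2
      · exact ((hHadj.1 hab).2 h2).elim
      · linarith
      · linarith
    convert h.reachable_inter (hwalk P) (hwalk Q) using 2
    ext z
    have := hPQ z
    simp only [Finset.mem_inter, Finset.mem_union, List.mem_toFinset, Finset.mem_insert,
      Finset.mem_singleton]
    have hx1 := P.start_mem_support
    have hx2 := Q.start_mem_support
    have hy1 := P.end_mem_support
    have hy2 := Q.end_mem_support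
    grind
  have hstrong : ∀ {A : Finset N} {x y}, (strongGraph G w A).Adj x y →
      H.Adj x y ∧ x ∈ A ∧ y ∈ A := by
    intro A x y hxy
    obtain ⟨hG, hx, hy, a, -, b, -, hab, hlt⟩ := strongGraph_adj.1 hxy
    refine ⟨hHadj.2 ⟨hG, fun h2 => ?_⟩, hx, hy⟩
    rcases weight_cases hw hab with h3 | h3 | h3 <;> linarith
  have hends : ∀ x ∈ p.support, ∀ y ∈ p.support, x ≠ y → x = v₁ ∨ x = v₂ → H.Adj x y := by
    intro x hx y hy hxy hx12
    obtain ⟨z, hz⟩ := exists_adj_of_reachable (hshort x hx y hy hxy) hxy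
    obtain ⟨hxz, -, hzA⟩ := hstrong hz
    have h2 := hxz.ne
    have h3 : ¬ H.Adj v₂ v₁ := fun h => hH12 h.symm
    simp only [Finset.mem_insert, Finset.mem_singleton] at hzA
    grind
  have h12 : ¬ (v₁ ∈ p.support ∧ v₂ ∈ p.support) := fun h2 =>
    hH12 (hends _ h2.1 _ h2.2 h1.1.ne (Or.inl rfl))
  intro x hx y hy hxy
  rw [Set.mem_ofPred_eq] at hx hy
  by_contra hnadj
  have hx12 : ¬ (x = v₁ ∨ x = v₂) := fun h2 => hnadj (hends x hx y hy hxy h2)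
  have hy12 : ¬ (y = v₁ ∨ y = v₂) := fun h2 => hnadj (hends y hy x hx hxy.symm h2).symm
  -- The cycle contains at most one of `v₁`, `v₂`, and that vertex is interior to at most one of the
  -- two arcs.
  obtain ⟨P, hP1, hP2⟩ : ∃ P : H.Walk x y, v₁ ∉ P.support ∧ v₂ ∉ P.support := by
    obtain ⟨P, Q, hP, hQ, hPQ⟩ := exists_arcs hp hx hy
    by_contra! hcon
    have hcP := hcon P
    have hcQ := hcon Q
    clear hstrong hHadj hshort hends hcon hmid hmax hlink hmin
    grind
  have hPσ : ∀ a ∈ P.support, ∀ b ∈ P.support, H.Adj a b → G.Adj a b ∧ w s(a, b) = σ₃ := by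
    intro a ha b hb hab
    obtain ⟨hab, hσ⟩ := hHadj.1 hab
    refine ⟨hab, ?_⟩
    rcases weight_cases hw hab with h2 | h2 | h2
    · exact (hσ h2).elim
    · rcases Sym2.mem_iff.1 (hmid _ ⟨hab, h2⟩) with rfl | rfl
      · exact (hP2 ha).elim
      · exact (hP2 hb).elim
    · exact h2
  obtain ⟨a, ha, ha2⟩ : ∃ a ∈ P.support, G.Adj a v₂ ∧ w s(a, v₂) = σ₂ := by
    cases P with
    | nil => exact (hxy rfl).elim
    | @cons _ b _ hxb P =>
      rcases hlink s(x, b) (hPσ _ (by simp) _ (by simp) hxb) with h2 | ⟨e, he, h2⟩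
      · rw [isLinkedBy_iff, Sym2.congr_left, Sym2.congr_left] at h2
        rcases h2 with rfl | rfl <;> simp at hP1
      · rw [isLinkedBy_iff] at h2
        rcases h2 with rfl | rfl
        · exact ⟨_, by simp, he⟩
        · exact ⟨_, by simp, he⟩
  have hr : (strongGraph G w (P.support.toFinset ∪ {v₂})).Reachable x y := by
    refine reachable_of_walk P fun b hb c hc hbc => strongGraph_adj.2
      ⟨(hHadj.1 hbc).1, by simp [hb], by simp [hc], a, by simp [ha], v₂, by simp, ha2.1, ?_⟩
    rw [ha2.2, (hPσ b hb c hc hbc).2]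
    exact h₂₃
  -- In the intersection `{x, y, v₂}`, a non-minimal edge at `x` can only go to `v₂`. It has weight
  -- `σ₂`, so a lighter edge must be `e₁`, but `v₁` is absent.
  obtain ⟨z, hz⟩ := exists_adj_of_reachable
    (h.reachable_inter hr (hshort x hx y hy hxy)) hxy
  have hA : ∀ b ∈ (P.support.toFinset ∪ {v₂}) ∩ {x, y, v₁, v₂}, b = x ∨ b = y ∨ b = v₂ := by
    intro b hb
    simp only [Finset.mem_inter, Finset.mem_union, List.mem_toFinset, Finset.mem_insert,
      Finset.mem_singleton] at hb
    grind
  obtain ⟨hxz, hxA, hzA⟩ := hstrong hz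
  have hz2 : z = v₂ := by
    have := hA z hzA
    have := hxz.ne
    grind
  subst hz2
  obtain ⟨hG2, -, -, b, hb, c, hc, hbc, hlt⟩ := strongGraph_adj.1 hz
  have hσ : w s(x, z) = σ₂ := by
    rcases weight_cases hw hG2 with h2 | h2 | h2
    · exact ((hHadj.1 hxz).2 h2).elim
    · exact h2
    · exact (hmax _ ⟨hG2, h2⟩ (by simp)).elim
  have hbcσ : w s(b, c) = σ₁ := by
    rcases weight_cases hw hbc with h2 | h2 | h2 <;> linarith
  have : s(b, c) ∈ weightClass G w σ₁ := ⟨hbc, hbcσ⟩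
  rw [hmin, Set.mem_singleton_iff, Sym2.eq_iff] at this
  have hb' := hA b hb
  have hc' := hA c hc
  have := h1.1.ne
  grind

end Necessity

/-! ### Triangles and chordless squares through a given edge -/

section ShortCycles

variable {N : Type*} {G : SimpleGraph N}

lemma exists_of_length_three {a : N} {p : G.Walk a a} (hl : p.length = 3) {x y : N}
    (hxy : s(x, y) ∈ p.edgeSet) :
    ∃ c, G.Adj y c ∧ G.Adj c x ∧ p.edgeSet = {s(x, y), s(y, c), s(c, x)} := by
  match p, hl with
  | .cons (v := b) hab (.cons (v := c) hbc (.cons hca .nil)), _ =>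
    have hs : (SimpleGraph.Walk.cons hab (.cons hbc (.cons hca .nil))).edgeSet =
        {s(a, b), s(b, c), s(c, a)} := by
      ext e
      simp [SimpleGraph.Walk.edgeSet]
    rw [hs] at hxy ⊢
    simp only [Set.mem_insert_iff, Set.mem_singleton_iff, Sym2.eq_iff] at hxy
    have e1 : s(b, a) = s(a, b) := Sym2.eq_swap
    have e2 : s(c, b) = s(b, c) := Sym2.eq_swap
    have e3 : s(a, c) = s(c, a) := Sym2.eq_swap
    have h1 := hab.symm
    have h2 := hbc.symm
    have h3 := hca.symm
    rcases hxy with (⟨rfl, rfl⟩ | ⟨rfl, rfl⟩) | (⟨rfl, rfl⟩ | ⟨rfl, rfl⟩) |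
      (⟨rfl, rfl⟩ | ⟨rfl, rfl⟩)
    · exact ⟨c, hbc, hca, rfl⟩
    · exact ⟨c, h3, h2, by rw [e1, e2, e3]; ext; simp; tauto⟩
    · exact ⟨a, hca, hab, by ext; simp; tauto⟩
    · exact ⟨a, h1, h3, by rw [e1, e2, e3]; ext; simp; tauto⟩
    · exact ⟨b, hab, hbc, by ext; simp; tauto⟩
    · exact ⟨b, h2, h1, by rw [e1, e2, e3]; ext; simp; tauto⟩

/-- `E` is the edge set of the chordless cycle on `x, y, c, d`, in this order. -/
def IsSquare (G : SimpleGraph N) (E : Set (Sym2 N)) (x y c d : N) : Prop :=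
  (G.Adj x y ∧ G.Adj y c ∧ G.Adj c d ∧ G.Adj d x ∧ ¬ G.Adj x c ∧ ¬ G.Adj y d ∧ c ≠ x ∧ d ≠ y) ∧
    E = {s(x, y), s(y, c), s(c, d), s(d, x)}

lemma IsSquare.rotate {E : Set (Sym2 N)} {x y c d : N} (h : IsSquare G E x y c d) :
    IsSquare G E y c d x := by
  obtain ⟨⟨h1, h2, h3, h4, h5, h6, h7, h8⟩, rfl⟩ := h
  refine ⟨⟨h2, h3, h4, h1, h6, fun h => h5 h.symm, h8, h7.symm⟩, ?_⟩
  ext e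
  simp only [Set.mem_insert_iff, Set.mem_singleton_iff]
  tauto

lemma IsSquare.reflect {E : Set (Sym2 N)} {x y c d : N} (h : IsSquare G E x y c d) :
    IsSquare G E y x d c := by
  obtain ⟨⟨h1, h2, h3, h4, h5, h6, h7, h8⟩, rfl⟩ := h
  refine ⟨⟨h1.symm, h4.symm, h3.symm, h2.symm, h6, h5, h8, h7⟩, ?_⟩
  rw [Sym2.eq_swap (a := y) (b := x), Sym2.eq_swap (a := x) (b := d),
    Sym2.eq_swap (a := d) (b := c), Sym2.eq_swap (a := c) (b := y)]
  ext e
  simp only [Set.mem_insert_iff, Set.mem_singleton_iff]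
  tauto

lemma exists_isSquare {a : N} {p : G.Walk a a} (hp : p.IsCycle) (hc : p.IsChordless)
    (hl : p.length = 4) : ∃ b c d, IsSquare G p.edgeSet a b c d := by
  match p, hl with
  | .cons (v := b) hab (.cons (v := c) hbc (.cons (v := d) hcd (.cons hda .nil))), _ =>
    have hs : (SimpleGraph.Walk.cons hab (.cons hbc (.cons hcd (.cons hda .nil)))).edgeSet =
        {s(a, b), s(b, c), s(c, d), s(d, a)} := by
      ext e
      simp [SimpleGraph.Walk.edgeSet]
    have hn := hp.support_nodup
    have h5 := @SimpleGraph.Walk.IsChordless.mem_edges _ _ _ _ _ hc a c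
    have h6 := @SimpleGraph.Walk.IsChordless.mem_edges _ _ _ _ _ hc b d
    have n1 := hab.ne
    have n2 := hbc.ne
    have n3 := hcd.ne
    have n4 := hda.ne
    simp at hn h5 h6
    refine ⟨b, c, d, ⟨hab, hbc, hcd, hda, ?_, ?_, ?_, ?_⟩, hs⟩ <;> clear hs hc hp <;> grind

lemma exists_of_length_four {a : N} {p : G.Walk a a} (hp : p.IsCycle) (hc : p.IsChordless)
    (hl : p.length = 4) {x y : N} (hxy : s(x, y) ∈ p.edgeSet) :
    ∃ c d, IsSquare G p.edgeSet x y c d := by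
  obtain ⟨b, c, d, h⟩ := exists_isSquare hp hc hl
  rw [h.2] at hxy
  simp only [Set.mem_insert_iff, Set.mem_singleton_iff, Sym2.eq_iff] at hxy
  rcases hxy with (⟨rfl, rfl⟩ | ⟨rfl, rfl⟩) | (⟨rfl, rfl⟩ | ⟨rfl, rfl⟩) |
    (⟨rfl, rfl⟩ | ⟨rfl, rfl⟩) | (⟨rfl, rfl⟩ | ⟨rfl, rfl⟩)
  · exact ⟨_, _, h⟩
  · exact ⟨_, _, h.reflect⟩
  · exact ⟨_, _, h.rotate⟩
  · exact ⟨_, _, h.rotate.reflect⟩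
  · exact ⟨_, _, h.rotate.rotate⟩
  · exact ⟨_, _, h.rotate.rotate.reflect⟩
  · exact ⟨_, _, h.rotate.rotate.rotate⟩
  · exact ⟨_, _, h.rotate.rotate.rotate.reflect⟩

end ShortCycles

/-! ### Condition 4 from condition 5 -/

section ShortCycleUnique

variable {N : Type*} {H : SimpleGraph N}

/-- In a cycle-complete graph with `x`, `y` not adjacent, distinct neighbours `c`, `d` of `x`
are not joined by a path through `y` avoiding `x`. -/
lemma IsCycleComplete.false_of_path (hH : IsCycleComplete H) {x y c d : N} (hxy : ¬ H.Adj x y)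
    (hne : x ≠ y) (p : H.Walk c d) (hp : p.IsPath) (hx : x ∉ p.support) (hy : y ∈ p.support)
    (hc : H.Adj x c) (hd : H.Adj x d) (hcd : c ≠ d) : False :=
  hxy (hH.isClique_of_isPath p hp hx hc hd hcd (Or.inl rfl) (Or.inr hy) hne)

lemma IsCycleComplete.eq_of_common_neighbors (hH : IsCycleComplete H) {x y c d : N}
    (hxy : ¬ H.Adj x y) (hne : x ≠ y) (hxc : H.Adj x c) (hxd : H.Adj x d) (hyc : H.Adj y c)
    (hyd : H.Adj y d) : c = d := by
  by_contra hcd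
  refine hH.false_of_path hxy hne (.cons hyc.symm (.cons hyd .nil)) ?_ ?_ ?_ hxc hxd hcd
  · have := hyc.ne
    have := hyd.ne
    simp [SimpleGraph.Walk.isPath_def]
    grind
  · have := hxc.ne
    have := hxd.ne
    simp
    grind
  · simp

variable {G : SimpleGraph N} {w : Sym2 N → ℝ} {σ₁ : ℝ} {v₁ v₂ : N}

/-- Removing `e₁` leaves two paths from `v₁` to `v₂`. If they are internally disjoint, they form a
cycle on which `v₁` and `v₂` are not adjacent; chordlessness excludes the partial overlaps. -/
lemma IsCycleComplete.edgeSet_eq_of_chordless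
    (hH : IsCycleComplete (G.deleteEdges {s(v₁, v₂)})) (h12 : G.Adj v₁ v₂) {a b : N}
    {p : G.Walk a a} {q : G.Walk b b} (hp : p.IsCycle) (hpc : p.IsChordless)
    (hpl : p.length = 3 ∨ p.length = 4) (hpe : s(v₁, v₂) ∈ p.edgeSet) (hq : q.IsCycle)
    (hqc : q.IsChordless) (hql : q.length = 3 ∨ q.length = 4) (hqe : s(v₁, v₂) ∈ q.edgeSet) :
    p.edgeSet = q.edgeSet := by
  have hadj : ∀ {x y}, (G.deleteEdges {s(v₁, v₂)}).Adj x y ↔ G.Adj x y ∧ s(x, y) ≠ s(v₁, v₂) := by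
    simp [SimpleGraph.deleteEdges_adj]
  have hn12 : ¬ (G.deleteEdges {s(v₁, v₂)}).Adj v₁ v₂ := fun h => (hadj.1 h).2 rfl
  have hadj' : ∀ {x y}, G.Adj x y → (x ≠ v₁ ∧ x ≠ v₂) ∨ (y ≠ v₁ ∧ y ≠ v₂) →
      (G.deleteEdges {s(v₁, v₂)}).Adj x y := by
    intro x y hxy h
    refine hadj.2 ⟨hxy, fun h2 => ?_⟩
    rw [Sym2.eq_iff] at h2
    grind
  have hle : ∀ {x y}, (G.deleteEdges {s(v₁, v₂)}).Adj x y → G.Adj x y := fun h => (hadj.1 h).1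
  generalize G.deleteEdges {s(v₁, v₂)} = H at *
  have hne := h12.ne
  -- two paths of lengths two and three
  have h34 : ∀ {c c' d'}, G.Adj v₂ c → G.Adj c v₁ → G.Adj v₂ c' → G.Adj c' d' → G.Adj d' v₁ →
      ¬ G.Adj v₁ c' → ¬ G.Adj v₂ d' → c' ≠ v₁ → d' ≠ v₂ → False := by
    intro c c' d' h1 h2 h3 h4 h5 h6 h7 h8 h9
    have n1 := h1.ne
    have n2 := h2.ne
    have n3 := h3.ne
    have n4 := h4.ne
    have n5 := h5.ne
    have n6 : c ≠ c' := by
      rintro rfl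
      exact h6 h2.symm
    have n7 : c ≠ d' := by
      rintro rfl
      exact h7 h1
    have k1 := hadj' h1 (by grind)
    have k2 := hadj' h2 (by grind)
    have k3 := hadj' h3 (by grind)
    have k4 := hadj' h4 (by grind)
    have k5 := hadj' h5 (by grind)
    refine hH.false_of_path hn12 hne (.cons k1.symm (.cons k3 (.cons k4 .nil))) ?_ ?_ ?_ k2.symm
      k5.symm n7
    · simp [SimpleGraph.Walk.isPath_def]
      grind
    · simp
      grind
    · simp
  rcases hpl with hpl | hpl <;> rcases hql with hql | hql
  · obtain ⟨c, h1, h2, hpE⟩ := exists_of_length_three hpl hpe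
    obtain ⟨d, h3, h4, hqE⟩ := exists_of_length_three hql hqe
    have n1 := h1.ne
    have n2 := h2.ne
    have n3 := h3.ne
    have n4 := h4.ne
    rw [hpE, hqE, hH.eq_of_common_neighbors hn12 hne (hadj' h2.symm (by grind))
      (hadj' h4.symm (by grind)) (hadj' h1 (by grind)) (hadj' h3 (by grind))]
  · obtain ⟨c, h1, h2, hpE⟩ := exists_of_length_three hpl hpe
    obtain ⟨c', d', ⟨-, h3, h4, h5, h6, h7, h8, h9⟩, hqE⟩ := exists_of_length_four hq hqc hql hqe
    exact (h34 h1 h2 h3 h4 h5 h6 h7 h8 h9).elim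
  · obtain ⟨c, h1, h2, hpE⟩ := exists_of_length_three hql hqe
    obtain ⟨c', d', ⟨-, h3, h4, h5, h6, h7, h8, h9⟩, hqE⟩ := exists_of_length_four hp hpc hpl hpe
    exact (h34 h1 h2 h3 h4 h5 h6 h7 h8 h9).elim
  · obtain ⟨c, d, ⟨-, h1, h2, h3, h4, h5, h6, h7⟩, hpE⟩ := exists_of_length_four hp hpc hpl hpe
    obtain ⟨c', d', ⟨-, i1, i2, i3, i4, i5, i6, i7⟩, hqE⟩ := exists_of_length_four hq hqc hql hqe
    have n1 := h1.ne
    have n2 := h2.ne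
    have n3 := h3.ne
    have m1 := i1.ne
    have m2 := i2.ne
    have m3 := i3.ne
    have h1' := hadj' h1 (by grind)
    have h2' := hadj' h2 (by grind)
    have h3' := hadj' h3 (by grind)
    have i1' := hadj' i1 (by grind)
    have i2' := hadj' i2 (by grind)
    have i3' := hadj' i3 (by grind)
    -- A vertex shared in the same position forces the other one, since its two candidates are
    -- common neighbours of opposite, non-adjacent corners. A vertex shared in crossed positions
    -- would give a chord.
    rcases eq_or_ne c c' with rfl | hcc
    · rw [hpE, hqE, hH.eq_of_common_neighbors (x := v₁) (y := c) (fun h => h4 (hle h)) h6.symm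
        h3'.symm i3'.symm h2' i2']
    rcases eq_or_ne d d' with rfl | hdd
    · exact (hcc (hH.eq_of_common_neighbors (x := v₂) (y := d) (fun h => h5 (hle h)) h7.symm
        h1' i1' h2'.symm i2'.symm)).elim
    have hcd : c ≠ d' := by
      rintro rfl
      exact i5 h1
    have hdc : d ≠ c' := by
      rintro rfl
      exact h5 i1
    exfalso
    refine hH.false_of_path hn12 hne (.cons h2'.symm (.cons h1'.symm (.cons i1' (.cons i2' .nil))))
      ?_ ?_ ?_ h3'.symm i3'.symm hdd
    · simp [SimpleGraph.Walk.isPath_def]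
      grind
    · simp
      grind
    · simp

end ShortCycleUnique

/-- Inheritance of convexity implies the structure conditions. -/
lemma InheritsConvexity.exists_structureConditions {N : Type*} [DecidableEq N] {G : SimpleGraph N}
    {w : Sym2 N → ℝ} {σ₁ σ₂ σ₃ : ℝ} (h : InheritsConvexity G w) (hG : G.Connected)
    (h₁₂ : σ₁ < σ₂) (h₂₃ : σ₂ < σ₃) (hw : w '' G.edgeSet = {σ₁, σ₂, σ₃}) :
    ∃ v₁ v₂ : N, StructureConditions G w σ₁ σ₂ σ₃ v₁ v₂ := by
  obtain ⟨v₁, v₂, hmin, hmid, hmax⟩ := h.exists_center hG h₁₂ h₂₃ hw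
  have hlink := h.max_linked h₁₂ h₂₃ hw hmin hmid hmax
  have hcc := h.isCycleComplete h₁₂ h₂₃ hw hmin hmid hmax hlink
  have h12 : G.Adj v₁ v₂ := by
    have : s(v₁, v₂) ∈ weightClass G w σ₁ := by
      rw [hmin]
      rfl
    exact this.1
  refine ⟨v₁, v₂, hmin, hmid, hlink, ?_, hcc⟩
  rw [hmin] at hcc
  intro a b p q hp hpc hpl hpe hq hqc hql hqe
  exact hcc.edgeSet_eq_of_chordless h12 hp hpc hpl hpe hq hqc hql hqe

/-! ### Cycles through `v₁` that avoid the minimal edge -/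

namespace StructureConditions

variable {N : Type*} {G : SimpleGraph N} {w : Sym2 N → ℝ} {σ₁ σ₂ σ₃ : ℝ} {v₁ v₂ : N}

lemma deleteEdges_adj_of_ne (h : StructureConditions G w σ₁ σ₂ σ₃ v₁ v₂) {x y : N}
    (hxy : G.Adj x y) (hx1 : x ≠ v₁) (hx2 : x ≠ v₂) :
    (G.deleteEdges (weightClass G w σ₁)).Adj x y := by
  refine h.deleteEdges_adj.2 ⟨hxy, fun h2 => ?_⟩
  rw [Sym2.eq_iff] at h2
  tauto

lemma not_deleteEdges_adj (h : StructureConditions G w σ₁ σ₂ σ₃ v₁ v₂) :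
    ¬ (G.deleteEdges (weightClass G w σ₁)).Adj v₁ v₂ := fun h2 => (h.deleteEdges_adj.1 h2).2 rfl

lemma eq_of_common_neighbors (h : StructureConditions G w σ₁ σ₂ σ₃ v₁ v₂) {x y : N}
    (hx1 : G.Adj x v₁) (hx2 : G.Adj x v₂) (hy1 : G.Adj y v₁) (hy2 : G.Adj y v₂) : x = y :=
  h.cycleComplete.eq_of_common_neighbors h.not_deleteEdges_adj h.mem_min.1.ne
    (h.deleteEdges_adj_of_ne hx1 hx1.ne hx2.ne).symm
    (h.deleteEdges_adj_of_ne hy1 hy1.ne hy2.ne).symm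
    (h.deleteEdges_adj_of_ne hx2 hx1.ne hx2.ne).symm
    (h.deleteEdges_adj_of_ne hy2 hy1.ne hy2.ne).symm

lemma adj_or_adj (h : StructureConditions G w σ₁ σ₂ σ₃ v₁ v₂)
    (hw : w '' G.edgeSet = {σ₁, σ₂, σ₃}) {x y : N} (hxy : G.Adj x y)
    (hx1 : x ≠ v₁) (hx2 : x ≠ v₂) (hy1 : y ≠ v₁) (hy2 : y ≠ v₂) :
    w s(x, y) = σ₃ ∧ ((G.Adj x v₂ ∧ w s(x, v₂) = σ₂) ∨ (G.Adj y v₂ ∧ w s(y, v₂) = σ₂)) := by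
  have hσ : w s(x, y) = σ₃ := by
    rcases weight_cases hw hxy with h1 | h1 | h1
    · rw [h.weight_eq_min_iff hxy, Sym2.eq_iff] at h1
      tauto
    · rcases h.middle hxy h1 with rfl | rfl <;> tauto
    · exact h1
  refine ⟨hσ, ?_⟩
  rcases h.linked hxy hσ with h1 | h1 | h1
  · exact (hx1 h1.symm).elim
  · exact (hy1 h1.symm).elim
  · exact h1

/-- The support of a cycle avoiding the minimal edge is a clique that does not contain `v₂` if it
contains `v₁`. -/
lemma isClique_of_isAvoidingCycle (h : StructureConditions G w σ₁ σ₂ σ₃ v₁ v₂) {a : N}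
    {p : G.Walk a a} (hp : IsAvoidingCycle v₁ v₂ p) :
    G.IsClique {x | x ∈ p.support} ∧ v₂ ∉ p.support := by
  obtain ⟨hp, h1, h12⟩ := hp
  have he : ∀ e ∈ p.edges, e ∈ (G.deleteEdges (weightClass G w σ₁)).edgeSet := by
    intro e he
    rw [SimpleGraph.edgeSet_deleteEdges, h.unique_min_edge]
    refine ⟨p.edges_subset_edgeSet he, ?_⟩
    rintro rfl
    exact h12 he
  have hc := h.cycleComplete a _ (hp.transfer he)
  rw [SimpleGraph.Walk.support_transfer] at hc
  refine ⟨hc.mono (G.deleteEdges_le _), fun h2 => ?_⟩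
  exact h.not_deleteEdges_adj (hc h1 h2 h.mem_min.1.ne)

/-- All vertices of the cycle other than `v₁` are neighbours of `v₁`, so at most one of them is a
neighbour of `v₂`. Each edge among them needs such an end, namely `x`, which becomes the third
vertex of the triangle on `e₁`. -/
lemma exists_of_isAvoidingCycle [DecidableEq N] (h : StructureConditions G w σ₁ σ₂ σ₃ v₁ v₂)
    (hw : w '' G.edgeSet = {σ₁, σ₂, σ₃}) {a : N} {p : G.Walk a a} (hp : IsAvoidingCycle v₁ v₂ p) :
    p.length = 3 ∧ ∃ x y, G.Adj v₁ x ∧ G.Adj x y ∧ G.Adj y v₁ ∧ G.Adj x v₂ ∧ w s(x, v₂) = σ₂ ∧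
      ¬ G.Adj y v₂ ∧ y ≠ v₂ ∧ p.edgeSet = {s(v₁, x), s(x, y), s(y, v₁)} := by
  obtain ⟨hclique, h2⟩ := h.isClique_of_isAvoidingCycle hp
  obtain ⟨hp, h1, -⟩ := hp
  have hq : (p.rotate v₁ h1).IsCycle := by simpa using hp
  have hsupp : ∀ z ∈ (p.rotate v₁ h1).support, z ∈ p.support := by simp
  have hlen : (p.rotate v₁ h1).length = p.length := by simp
  have hedge : p.edgeSet = (p.rotate v₁ h1).edgeSet := by
    ext e
    exact (p.rotate_edges v₁ h1).mem_iff.symm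
  rw [← hlen, hedge]
  have hpair : ∀ x ∈ (p.rotate v₁ h1).support, ∀ y ∈ (p.rotate v₁ h1).support, x ≠ y →
      G.Adj x y ∧ x ≠ v₂ := by
    intro x hx y hy hxy
    refine ⟨hclique (hsupp x hx) (hsupp y hy) hxy, ?_⟩
    rintro rfl
    exact h2 (hsupp _ hx)
  generalize p.rotate v₁ h1 = q at hq hpair
  clear hsupp hlen hedge
  match q with
  | .nil => exact (hq.ne_nil rfl).elim
  | .cons h1 .nil => exact (h1.ne rfl).elim
  | .cons _ (.cons _ .nil) => exact absurd hq.three_le_length (by simp)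
  | .cons (v := x) hx (.cons (v := y) hxy (.cons hy .nil)) =>
    refine ⟨rfl, ?_⟩
    have hs : (SimpleGraph.Walk.cons hx (.cons hxy (.cons hy .nil))).edgeSet =
        {s(v₁, x), s(x, y), s(y, v₁)} := by
      ext e
      simp [SimpleGraph.Walk.edgeSet]
    have hs' : ({s(v₁, x), s(x, y), s(y, v₁)} : Set (Sym2 N)) =
        {s(v₁, y), s(y, x), s(x, v₁)} := by
      rw [Sym2.eq_swap (a := v₁) (b := x), Sym2.eq_swap (a := x) (b := y),
        Sym2.eq_swap (a := y) (b := v₁)]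
      ext e
      simp only [Set.mem_insert_iff, Set.mem_singleton_iff]
      tauto
    have hx2 : x ≠ v₂ := (hpair x (by simp) y (by simp) hxy.ne).2
    have hy2 : y ≠ v₂ := (hpair y (by simp) x (by simp) hxy.ne').2
    rcases (h.adj_or_adj hw hxy hx.ne' hx2 hy.ne hy2).2 with h3 | h3
    · refine ⟨x, y, hx, hxy, hy, h3.1, h3.2, fun h4 => ?_, hy2, hs⟩
      exact hxy.ne (h.eq_of_common_neighbors hx.symm h3.1 hy h4)
    · refine ⟨y, x, hy.symm, hxy.symm, hx.symm, h3.1, h3.2, fun h4 => ?_, hx2, hs.trans hs'⟩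
      exact hxy.ne (h.eq_of_common_neighbors hx.symm h4 hy h3.1)
  | .cons (v := x) hx (.cons (v := y) hxy (.cons (v := z) hyz (.cons hz q))) =>
    -- Three vertices besides `v₁` span a triangle; covering its edges takes two neighbours of `v₂`.
    exfalso
    have hn := hq.support_nodup
    simp only [SimpleGraph.Walk.support_cons, List.tail_cons, List.nodup_cons] at hn
    have hend := q.end_mem_support
    have hx1 : x ≠ v₁ := hx.ne'
    have hy1 : y ≠ v₁ := by
      rintro rfl
      simp [hend] at hn
    have hz1 : z ≠ v₁ := by
      rintro rfl
      simp [hend] at hn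
    have hxz : x ≠ z := by
      rintro rfl
      simp at hn
    have ax := hpair x (by simp) v₁ (by simp) hx1
    have ay := hpair y (by simp) v₁ (by simp) hy1
    have az := hpair z (by simp) v₁ (by simp) hz1
    have axz := hpair x (by simp) z (by simp) hxz
    have exy := (h.adj_or_adj hw hxy hx1 ax.2 hy1 ay.2).2
    have eyz := (h.adj_or_adj hw hyz hy1 ay.2 hz1 az.2).2
    have exz := (h.adj_or_adj hw axz.1 hx1 ax.2 hz1 az.2).2
    have c1 := fun h3 h4 => hxy.ne (h.eq_of_common_neighbors ax.1 h3 ay.1 h4)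
    have c2 := fun h3 h4 => hyz.ne (h.eq_of_common_neighbors ay.1 h3 az.1 h4)
    have c3 := fun h3 h4 => hxz (h.eq_of_common_neighbors ax.1 h3 az.1 h4)
    tauto

lemma avoidingCycleStructure [DecidableEq N] (h : StructureConditions G w σ₁ σ₂ σ₃ v₁ v₂)
    (hw : w '' G.edgeSet = {σ₁, σ₂, σ₃}) :
    AvoidingCycleStructure G w σ₁ σ₂ σ₃ v₁ v₂ := by
  intro a p hp
  obtain ⟨hl, x, y, h1x, hxy, hy1, hx2, hσ, hny, hy2, hE⟩ := h.exists_of_isAvoidingCycle hw hp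
  have hσ₃ : ∀ z, z ≠ v₂ → G.Adj z v₁ → w s(z, v₁) = σ₃ := by
    intro z hz hz1
    rcases weight_cases hw hz1 with h1 | h1 | h1
    · rw [h.weight_eq_min_iff hz1, Sym2.eq_iff] at h1
      have := hz1.ne
      tauto
    · rcases h.middle hz1 h1 with h2 | h2
      · exact (hz h2.symm).elim
      · exact (h.mem_min.1.ne h2.symm).elim
    · exact h1
  refine ⟨hl, ?_, ?_, x, h.mem_min.1, hx2.symm, h1x.symm, h.mem_min.2, ?_, hσ₃ x hx2.ne h1x.symm,
    ?_, ?_⟩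
  · intro b q hq
    obtain ⟨-, x', y', h1x', hxy', hy1', hx2', hσ', hny', hy2', hE'⟩ :=
      h.exists_of_isAvoidingCycle hw hq
    obtain rfl := h.eq_of_common_neighbors h1x.symm hx2 h1x'.symm hx2'
    suffices y = y' by rw [hE, hE', this]
    by_contra hyy
    have hadj : ∀ {y z : N}, G.Adj y v₁ → y ≠ v₂ → G.Adj y z →
        (G.deleteEdges (weightClass G w σ₁)).Adj y z :=
      fun hy hy2 hyz => h.deleteEdges_adj_of_ne hyz hy.ne hy2
    -- An edge between `y` and `y'` would need an end adjacent to `v₂`. Being non-adjacent, they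
    -- cannot share the two neighbours `v₁` and `x`.
    have hyy' : ¬ (G.deleteEdges (weightClass G w σ₁)).Adj y y' := fun h2 => by
      have := (h.adj_or_adj hw (h.deleteEdges_adj.1 h2).1 hy1.ne hy2 hy1'.ne hy2').2
      tauto
    exact h1x.ne (h.cycleComplete.eq_of_common_neighbors hyy' hyy (hadj hy1 hy2 hy1)
      (hadj hy1 hy2 hxy.symm) (hadj hy1' hy2' hy1') (hadj hy1' hy2' hxy'.symm))
  · intro e he
    rw [hE] at he
    rcases he with rfl | rfl | rfl
    · rw [Sym2.eq_swap]
      exact hσ₃ x hx2.ne h1x.symm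
    · exact (h.adj_or_adj hw hxy h1x.ne' hx2.ne hy1.ne hy2).1
    · exact hσ₃ y hy2 hy1
  · rwa [Sym2.eq_swap]
  · rw [hE, Sym2.eq_swap (a := v₁) (b := x)]
    have := h1x.ne
    have := hx2.ne
    have := hxy.ne
    have := h.mem_min.1.ne
    ext e
    simp only [Set.mem_inter_iff, Set.mem_insert_iff, Set.mem_singleton_iff]
    constructor
    · rintro ⟨rfl | rfl | rfl, h2⟩
      · rfl
      · simp only [Sym2.eq_iff] at h2 ⊢
        grind
      · simp only [Sym2.eq_iff] at h2 ⊢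
        grind
    · rintro rfl
      simp
  · intro b q _ hq3 hqe _
    obtain ⟨c, h2c, hc1, hqE⟩ := exists_of_length_three hq3 hqe
    rw [hqE, h.eq_of_common_neighbors hc1 h2c.symm h1x.symm hx2]

end StructureConditions
end PminGame

theorem mainTheorem1 {N : Type*} [Fintype N] [DecidableEq N] (G : SimpleGraph N)
    (w : Sym2 N → ℝ) (σ₁ σ₂ σ₃ : ℝ) (hG : G.Connected) (h₁₂ : σ₁ < σ₂) (h₂₃ : σ₂ < σ₃)
    (hw : w '' G.edgeSet = {σ₁, σ₂, σ₃}) :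
    (PminGame.InheritsConvexity G w ↔
      ∃ v₁ v₂ : N, PminGame.StructureConditions G w σ₁ σ₂ σ₃ v₁ v₂) ∧
    ∀ v₁ v₂ : N, PminGame.StructureConditions G w σ₁ σ₂ σ₃ v₁ v₂ →
      PminGame.AvoidingCycleStructure G w σ₁ σ₂ σ₃ v₁ v₂ := by
  refine ⟨⟨fun h => h.exists_structureConditions hG h₁₂ h₂₃ hw, ?_⟩,
    fun v₁ v₂ h => h.avoidingCycleStructure hw⟩
  rintro ⟨v₁, v₂, h⟩
  exact h.inheritsConvexity h₁₂ h₂₃ hw
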